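/- **Setting.** States are ${\bf U}=(\rho,{\bf m},{\bf B},E)\in\mathbb R^8$ with ${\bf m},{\bf B}\in\mathbb R^3$, ${\bf v}={\bf m}/\rho$, $\mathcal E({\bf U})=E-\frac12(|{\bf m}|^2/\rho+|{\bf B}|^2)=\rho e$, and $\mathcal G=\{{\bf U}:\rho>0,\ \mathcal E({\bf U})>0\}$. The equation of state $p=p(\rho,e)$ is arbitrary with $e>0\Leftrightarrow p(\rho,e)>0$ for $\rho>0$; $p_{\rm tot}=p+|{\bf B}|^2/2$. The MHD fluxes are ${\bf F}_i=(\rho v_i,\ \rho v_i{\bf v}-B_i{\bf B}+p_{\rm tot}{\bf e}_i,\ v_i{\bf B}-B_i{\bf v},\ v_i(E+p_{\rm tot})-B_i({\bf v}\cdot{\bf B}))$, $i=1,2$, and the Godunov–Powell source is ${\bf S}({\bf U})=(0,{\bf B},{\bf v},{\bf v}\cdot{\bf B})$. For ${\bm\xi}\in\mathbb R^2$ write $\langle{\bm\xi},\cdot\rangle=\xi_1(\cdot)_1+\xi_2(\cdot)_2$. With ${\mathscr C}_s=\frac{p}{\rho\sqrt{2e}}$ and $a={\mathscr C}_s^2+|{\bf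 B}|^2/\rho$ let $${\mathscr C}({\bf U};{\bm\xi})=\tfrac1{\sqrt2}\Big[a+\sqrt{a^2-4{\mathscr C}_s^2\langle{\bm\xi},{\bf B}\rangle^2/\rho}\,\Big]^{1/2},\qquad {\bf w}({\bf U},\tilde{\bf U})=\frac{\sqrt\rho\,{\bf v}+\sqrt{\tilde\rho}\,\tilde{\bf v}}{\sqrt\rho+\sqrt{\tilde\rho}},\qquad b({\bf U},\tilde{\bf U})=\frac{|{\bf B}-\tilde{\bf B}|}{\sqrt\rho+\sqrt{\tilde\rho}},$$ $$\alpha_r({\bf U},\tilde{\bf U};{\bm\xi})=\max\{\langle{\bm\xi},{\bf v}\rangle,\langle{\bm\xi},{\bf w}\rangle\}+{\mathscr C}({\bf U};{\bm\xi})+b,\qquad \alpha_l({\bf U},\tilde{\bf U};{\bm\xi})=\min\{\langle{\bm\xi},{\bf v}\rangle,\langle{\bm\xi},{\bf w}\rangle\}-{\mathscr C}({\bf U};{\bm\xi})-b .$$ HLL wave speeds are functions $\sigma_l<\sigma_r$ of $({\bf U}^-,{\bf U}^+;{\bm\xi})$ (for ${\bf U}^\pm\in\mathcal G$, $|{\bm\xi}|=1$)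 with $\sigma_r({\bf U}^-,{\bf U}^+;{\bm\xi})=-\sigma_l({\bf U}^+,{\bf U}^-;-{\bm\xi})$; $\sigma^+=\max\{\sigma_r,0\}$, $\sigma^-=\min\{\sigma_l,0\}$, $\eta=\sigma^- /(\sigma^+-\sigma^-)$, and the HLL flux is $$\hat{\bf F}({\bf U}^-,{\bf U}^+;{\bm\xi})=\frac{\sigma^+\langle{\bm\xi},{\bf F}({\bf U}^-)\rangle-\sigma^-\langle{\bm\xi},{\bf F}({\bf U}^+)\rangle+\sigma^-\sigma^+({\bf U}^+-{\bf U}^-)}{\sigma^+-\sigma^-}.$$ Let $\mathcal T_h$ be a mesh of a planar domain into simple polygonal cells $K$ (hanging nodes count as vertices), with area $|K|$, edges ${\mathscr E}_K^j$ of length $|{\mathscr E}_K^j|$, $1\le j\le N_K$, outward unit normals ${\bm\xi}_K^{(j)}$, adjacent cells $K_j$, and $|\partial K|=\sum_j|{\mathscr E}_K^j|$. Let $k\ge0$. On the edges use a $Q$-point quadrature with nodes ${\bf x}_K^{(jq)}\in{\mathscr E}_K^j$ (the two cells sharing an edge use the same nodes) and weights $\omega_q>0$ that integrates the mean over each edge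 exactly for polynomials of degree $\le k$. On each cell let there be weights $\varpi_{jq},\widetilde\varpi_q>0$ (depending on $K$) and nodes $\widetilde{\bf x}_K^{(q)}\in K$ with $$\frac1{|K|}\int_K u\,d{\bf x}=\sum_{j=1}^{N_K}\sum_{q=1}^Q\varpi_{jq}\,u({\bf x}_K^{(jq)})+\sum_{q=1}^{\widetilde Q}\widetilde\varpi_q\,u(\widetilde{\bf x}_K^{(q)})\qquad\text{for all polynomials }u\text{ of degree}\le k,$$ and let $\mathbb S_K$ be the set of all the nodes ${\bf x}_K^{(jq)},\widetilde{\bf x}_K^{(q)}$. Let $\widetilde{\bf U}_K^n$, $K\in\mathcal T_h$, be the limited solution: $\mathbb R^8$-valued polynomials of degree $\le k$ whose cell averages are $\bar{\bf U}_K^n$. Put ${\bf U}^{\rm int}_{jq}=\widetilde{\bf U}^n_K({\bf x}_K^{(jq)})$ and ${\bf U}^{\rm ext}_{jq}=\widetilde{\bf U}^n_{K_j}({\bf x}_K^{(jq)})$; on edges on the boundary of the domain, if there are any, ${\bf U}^{\rm ext}_{jq}\in\mathcal G$ is a given boundary state. Let $\sigma^{K,\pm}_{jq}$, $\eta_{jq}$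 be the values of $\sigma^\pm$, $\eta$ at $({\bf U}^{\rm int}_{jq},{\bf U}^{\rm ext}_{jq};{\bm\xi}_K^{(j)})$. The cell averages of the DG or finite-volume scheme, with time step $\Delta t_n>0$, are updated by $$\bar{\bf U}_K^{n+1}=\bar{\bf U}_K^n-\frac{\Delta t_n}{|K|}\sum_{j=1}^{N_K}\sum_{q=1}^Q|{\mathscr E}_K^j|\,\omega_q\Big[\hat{\bf F}({\bf U}^{\rm int}_{jq},{\bf U}^{\rm ext}_{jq};{\bm\xi}_K^{(j)})-\eta_{jq}\big\langle{\bm\xi}_K^{(j)},{\bf B}^{\rm ext}_{jq}-{\bf B}^{\rm int}_{jq}\big\rangle{\bf S}({\bf U}^{\rm int}_{jq})\Big].\qquad(*)$$ **Theorem.** Assume that 1. the polynomials $\widetilde{\bf U}_K^n$ are locally divergence-free: $\partial_{x_1}\widetilde B_1+\partial_{x_2}\widetilde B_2=0$ in each $K$; 2. $\widetilde{\bf U}_K^n({\bf x})\in\mathcal G$ for all ${\bf x}\in\mathbb S_K$ and all $K$; 3. the wave speeds satisfy $\sigma_r({\bf U}^-,{\bf U}^+;{\bm\xi})\ge\alpha_r({\bf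 U}^+,{\bf U}^-;{\bm\xi})$ and $\sigma_l({\bf U}^-,{\bf U}^+;{\bm\xi})\le\alpha_l({\bf U}^-,{\bf U}^+;{\bm\xi})$ for $({\bf U}^-,{\bf U}^+;{\bm\xi})=({\bf U}^{\rm int}_{jq},{\bf U}^{\rm ext}_{jq};{\bm\xi}_K^{(j)})$, for all $K,j,q$; 4. $\displaystyle \Delta t_n\frac{|{\mathscr E}_K^j|}{|K|}\,\alpha_{jq}^K<\frac{\varpi_{jq}}{\omega_q}$ for all $K,j,q$, where $$\alpha_{jq}^K=\widehat\alpha_{jq}-\sigma_{jq}^{K,-}-\eta_{jq}\,(\rho^{\rm int}_{jq})^{-1/2}\,\big|\big\langle{\bm\xi}_K^{(j)},{\bf B}^{\rm int}_{jq}-{\bf B}^{\rm ext}_{jq}\big\rangle\big|,$$ $$\widehat\alpha_{jq}={\mathscr C}({\bf U}^{\rm int}_{jq};{\bm\xi}_K^{(j)})+\frac2{|\partial K|}\sum_{i=1}^{N_K}|{\mathscr E}_K^i|\,b({\bf U}^{\rm int}_{jq},{\bf U}^{\rm int}_{iq})+\max\Big\{\langle{\bm\xi}_K^{(j)},{\bf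 v}^{\rm int}_{jq}\rangle,\ \frac1{|\partial K|}\sum_{i=1}^{N_K}|{\mathscr E}_K^i|\big\langle{\bm\xi}_K^{(j)}-{\bm\xi}_K^{(i)},{\bf w}({\bf U}^{\rm int}_{jq},{\bf U}^{\rm int}_{iq})\big\rangle\Big\}.$$ Then $\bar{\bf U}_K^{n+1}$ given by $(*)$ belongs to $\mathcal G$ for all $K\in\mathcal T_h$. -/

import Mathlib

open MeasureTheory Filter Topology

noncomputable section

namespace MHD

/-! ### States, equation of state, flux and source -/

/-- Points and vectors of the plane, with the Euclidean norm. -/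
abbrev Plane := EuclideanSpace ℝ (Fin 2)

/-- Three-component vectors (velocity, momentum, magnetic field), with the Euclidean norm. -/
abbrev Vec3 := EuclideanSpace ℝ (Fin 3)

/-- A conservative vector `(ρ, m₁, m₂, m₃, B₁, B₂, B₃, E)`. -/
abbrev State := Fin 8 → ℝ

/-- The conservative vector with the given blocks. -/
def mkState (r : ℝ) (m B : Vec3) (E : ℝ) : State :=
  ![r, m 0, m 1, m 2, B 0, B 1, B 2, E]

/-- Density. -/
def rho (U : State) : ℝ := U 0

/-- Momentum. -/
def mom (U : State) : Vec3 := !₂[U 1, U 2, U 3]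

/-- Magnetic field. -/
def mag (U : State) : Vec3 := !₂[U 4, U 5, U 6]

/-- Total energy. -/
def energy (U : State) : ℝ := U 7

/-- Velocity `m / ρ`. -/
def vel (U : State) : Vec3 := (rho U)⁻¹ • mom U

/-- Internal energy `E - (|m|² / ρ + |B|²) / 2`. -/
def internalEnergy (U : State) : ℝ :=
  energy U - (1 / 2) * (‖mom U‖ ^ 2 / rho U + ‖mag U‖ ^ 2)

/-- The set of physically admissible states. -/
def admissible : Set State := {U | 0 < rho U ∧ 0 < internalEnergy U}

/-- Specific internal energy `e`, from `internalEnergy = ρ e`. -/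
def specificEnergy (U : State) : ℝ := internalEnergy U / rho U

/-- A general equation of state `p = p(ρ, e)` such that, for positive density, the pressure is
positive exactly when the specific internal energy is. -/
structure EOS where
  p : ℝ → ℝ → ℝ
  pos_iff : ∀ ρ e : ℝ, 0 < ρ → (0 < e ↔ 0 < p ρ e)

/-- Gas pressure of a state. -/
def pressure (eos : EOS) (U : State) : ℝ := eos.p (rho U) (specificEnergy U)

/-- Total pressure, gas plus magnetic. -/
def totalPressure (eos : EOS) (U : State) : ℝ := pressure eos U + ‖mag U‖ ^ 2 / 2

/-- The MHD flux in the `i`-th coordinate direction. -/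
def flux (eos : EOS) (i : Fin 3) (U : State) : State :=
  mkState (rho U * vel U i)
    ((rho U * vel U i) • vel U - mag U i • mag U
      + totalPressure eos U • EuclideanSpace.single i (1 : ℝ))
    (vel U i • mag U - mag U i • vel U)
    (vel U i * (energy U + totalPressure eos U) - mag U i * inner ℝ (vel U) (mag U))

/-- The pairing `⟨ξ, w⟩ = ξ₁ w₁ + ξ₂ w₂` of a planar vector with a three-component vector. -/
def pair (ξ : Plane) (w : Vec3) : ℝ := ∑ i : Fin 2, ξ i * w i.castSucc

/-- The flux `⟨ξ, F(U)⟩ = ξ₁ F₁(U) + ξ₂ F₂(U)` in the direction `ξ`. -/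
def normalFlux (eos : EOS) (ξ : Plane) (U : State) : State :=
  ∑ i : Fin 2, ξ i • flux eos i.castSucc U

/-- The Godunov--Powell source vector `S(U) = (0, B, v, v · B)`. -/
def source (U : State) : State :=
  mkState 0 (mag U) (vel U) (inner ℝ (vel U) (mag U))

/-! ### The HLL flux -/

/-- `p / (ρ √(2 e))`. -/
def soundC (eos : EOS) (U : State) : ℝ :=
  pressure eos U / (rho U * √(2 * specificEnergy U))

/-- The speed `𝒞(U; ξ)`. -/
def speedC (eos : EOS) (U : State) (ξ : Plane) : ℝ :=
  (1 / √2) * √(soundC eos U ^ 2 + ‖mag U‖ ^ 2 / rho U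
    + √((soundC eos U ^ 2 + ‖mag U‖ ^ 2 / rho U) ^ 2
        - 4 * (soundC eos U ^ 2 * pair ξ (mag U) ^ 2 / rho U)))

/-- The average of two velocities with weights `√ρ` and `√ρ'`. -/
def roeVel (U U' : State) : Vec3 :=
  (√(rho U) + √(rho U'))⁻¹ • (√(rho U) • vel U + √(rho U') • vel U')

/-- The quantity `|B - B'| / (√ρ + √ρ')`. -/
def magJump (U U' : State) : ℝ := ‖mag U - mag U'‖ / (√(rho U) + √(rho U'))

/-- `α_r(U, U'; ξ)`. -/
def alphaR (eos : EOS) (U U' : State) (ξ : Plane) : ℝ :=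
  max (pair ξ (vel U)) (pair ξ (roeVel U U')) + speedC eos U ξ + magJump U U'

/-- `α_l(U, U'; ξ)`. -/
def alphaL (eos : EOS) (U U' : State) (ξ : Plane) : ℝ :=
  min (pair ξ (vel U)) (pair ξ (roeVel U U')) - speedC eos U ξ - magJump U U'

/-- The wave speed estimates of an HLL flux, as functions of the left state, the right state and
the unit normal: the right speed exceeds the left one, and the resulting flux is conservative. -/
structure HLLSpeeds where
  left : State → State → Plane → ℝ
  right : State → State → Plane → ℝ
  left_lt_right : ∀ U ∈ admissible, ∀ U' ∈ admissible, ∀ ξ : Plane, ‖ξ‖ = 1 →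
    left U U' ξ < right U U' ξ
  conservative : ∀ U ∈ admissible, ∀ U' ∈ admissible, ∀ ξ : Plane, ‖ξ‖ = 1 →
    right U U' ξ = - left U' U (-ξ)

/-- `σ⁺ = max {σ_r, 0}`. -/
def HLLSpeeds.plus (σ : HLLSpeeds) (U U' : State) (ξ : Plane) : ℝ := max (σ.right U U' ξ) 0

/-- `σ⁻ = min {σ_l, 0}`. -/
def HLLSpeeds.minus (σ : HLLSpeeds) (U U' : State) (ξ : Plane) : ℝ := min (σ.left U U' ξ) 0

/-- The HLL flux with left state `U`, right state `U'` and unit normal `ξ`. -/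
def hllFlux (eos : EOS) (σ : HLLSpeeds) (U U' : State) (ξ : Plane) : State :=
  (σ.plus U U' ξ - σ.minus U U' ξ)⁻¹ •
    (σ.plus U U' ξ • normalFlux eos ξ U - σ.minus U U' ξ • normalFlux eos ξ U'
      + (σ.minus U U' ξ * σ.plus U U' ξ) • (U' - U))

/-- The upwind factor `η = σ⁻ / (σ⁺ - σ⁻)` of the penalty term. -/
def upwindFactor (σ : HLLSpeeds) (U U' : State) (ξ : Plane) : ℝ :=
  σ.minus U U' ξ / (σ.plus U U' ξ - σ.minus U U' ξ)

/-- The wave speed condition at one interface: `σ_r ≥ α_r(U⁺, U⁻; ξ)` and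
`σ_l ≤ α_l(U⁻, U⁺; ξ)`, where `U⁻`, `U⁺` are the left and right states. -/
def WaveSpeedCondition (eos : EOS) (σ : HLLSpeeds) (Um Up : State) (ξ : Plane) : Prop :=
  alphaR eos Up Um ξ ≤ σ.right Um Up ξ ∧ σ.left Um Up ξ ≤ alphaL eos Um Up ξ

/-! ### Polygonal cells and meshes -/

/-- A polygonal cell: the closed region `region` bounded by a simple closed polygon, whose
vertices are listed counterclockwise. Consecutive edges may be collinear. The `j`-th edge joins
`vertex j` to the cyclically next vertex. The last field says that the region lies to the left of
each edge, so that the right normal of the edge is the outward one. -/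
structure PolygonalCell where
  numEdges : ℕ
  three_le : 3 ≤ numEdges
  vertex : Fin numEdges → Plane
  vertex_injective : Function.Injective vertex
  simple : ∀ i j : Fin numEdges, i ≠ j →
    Disjoint (openSegment ℝ (vertex i) (vertex (finRotate numEdges i)))
      (segment ℝ (vertex j) (vertex (finRotate numEdges j)))
  region : Set Plane
  isCompact_region : IsCompact region
  interior_nonempty : (interior region).Nonempty
  frontier_region :
    frontier region = ⋃ j, segment ℝ (vertex j) (vertex (finRotate numEdges j))
  counterclockwise : ∀ j : Fin numEdges,
    ∀ x ∈ openSegment ℝ (vertex j) (vertex (finRotate numEdges j)),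
      ∀ᶠ t : ℝ in 𝓝[>] 0,
        x + t • (!₂[vertex (finRotate numEdges j) 1 - vertex j 1,
          vertex j 0 - vertex (finRotate numEdges j) 0] : Plane) ∉ region ∧
        x - t • (!₂[vertex (finRotate numEdges j) 1 - vertex j 1,
          vertex j 0 - vertex (finRotate numEdges j) 0] : Plane) ∈ region

namespace PolygonalCell

variable (K : PolygonalCell)

/-- The end point of the `j`-th edge. -/
def nextVertex (j : Fin K.numEdges) : Plane := K.vertex (finRotate K.numEdges j)

/-- The `j`-th edge. -/
def edge (j : Fin K.numEdges) : Set Plane := segment ℝ (K.vertex j) (K.nextVertex j)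

/-- The length of the `j`-th edge. -/
def edgeLength (j : Fin K.numEdges) : ℝ := dist (K.vertex j) (K.nextVertex j)

/-- The outward unit normal vector of the `j`-th edge. -/
def normal (j : Fin K.numEdges) : Plane :=
  (K.edgeLength j)⁻¹ • !₂[K.nextVertex j 1 - K.vertex j 1, K.vertex j 0 - K.nextVertex j 0]

/-- The area of the cell. -/
def area : ℝ := volume.real K.region

/-- The circumference of the cell. -/
def perimeter : ℝ := ∑ j, K.edgeLength j

end PolygonalCell

/-- A polygonal mesh with cells indexed by `ι`: the cells have disjoint interiors and cover the
domain, which is their union. Each edge either is shared with an adjacent cell or lies on the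
boundary of the domain, touching no other cell except at its end points. Hanging nodes count as
vertices. -/
structure PolygonalMesh (ι : Type*) where
  cell : ι → PolygonalCell
  disjoint_interior : ∀ K L : ι, K ≠ L →
    Disjoint (interior (cell K).region) (interior (cell L).region)
  /-- The cell on the other side of an edge; `none` for an edge on the boundary of the domain. -/
  neighbor : (K : ι) → Fin (cell K).numEdges → Option ι
  neighbor_some : ∀ (K : ι) (j : Fin (cell K).numEdges) (L : ι), neighbor K j = some L →
    L ≠ K ∧ ∃ i, (cell L).edge i = (cell K).edge j
  neighbor_none : ∀ (K : ι) (j : Fin (cell K).numEdges), neighbor K j = none →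
    ∀ L : ι, L ≠ K →
      Disjoint (openSegment ℝ ((cell K).vertex j) ((cell K).nextVertex j)) (cell L).region

/-! ### Piecewise polynomials and quadratures -/

/-- The value of a bivariate polynomial at a point of the plane. -/
def evalAt (u : MvPolynomial (Fin 2) ℝ) (x : Plane) : ℝ := MvPolynomial.eval (fun i => x i) u

/-- The value of a vector of eight polynomials at a point of the plane. -/
def stateAt (P : Fin 8 → MvPolynomial (Fin 2) ℝ) (x : Plane) : State := fun l => evalAt (P l) x

/-- The locally divergence-free piecewise polynomials: one vector of eight polynomials of degree
at most `k` per cell, with `∂B₁/∂x₁ + ∂B₂/∂x₂ = 0` in each cell. -/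
def locallyDivFree (ι : Type*) (k : ℕ) : Set (ι → Fin 8 → MvPolynomial (Fin 2) ℝ) :=
  {P | ∀ K, (∀ l, (P K l).totalDegree ≤ k) ∧
    MvPolynomial.pderiv 0 (P K 4) + MvPolynomial.pderiv 1 (P K 5) = 0}

/-- The average over a cell of a vector of eight polynomials. -/
def cellAverage (K : PolygonalCell) (P : Fin 8 → MvPolynomial (Fin 2) ℝ) : State :=
  fun l => K.area⁻¹ * ∫ x in K.region, evalAt (P l) x

variable {ι : Type*}

/-- A `Q`-point quadrature rule on the edges of a mesh: positive weights, nodes on the edge, and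
exactness for the mean over each edge (with respect to length) of all polynomials of degree at
most `k`. The nodes belong to the interface, so the two cells sharing an edge see the same nodes,
possibly in a different order. -/
structure EdgeQuadrature (M : PolygonalMesh ι) (k Q : ℕ) where
  weight : Fin Q → ℝ
  weight_pos : ∀ q, 0 < weight q
  node : (K : ι) → Fin (M.cell K).numEdges → Fin Q → Plane
  node_mem : ∀ K j q, node K j q ∈ (M.cell K).edge j
  exact_of_degree_le : ∀ K j (u : MvPolynomial (Fin 2) ℝ), u.totalDegree ≤ k →
    ∫ t in (0 : ℝ)..1,
        evalAt u (AffineMap.lineMap ((M.cell K).vertex j) ((M.cell K).nextVertex j) t)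
      = ∑ q, weight q * evalAt u (node K j q)
  shared : ∀ (K : ι) (j : Fin (M.cell K).numEdges) (L : ι) (i : Fin (M.cell L).numEdges),
    M.neighbor K j = some L → (M.cell L).edge i = (M.cell K).edge j →
      Set.range (node L i) = Set.range (node K j)

/-- The special quadrature on the cells: positive weights, nodes in the cell which include all
edge nodes of the given edge quadrature, and exactness for the cell average of all polynomials of
degree at most `k`. (For the polynomial `1` this says that the weights sum to one.) -/
structure CellQuadrature {M : PolygonalMesh ι} {k Q : ℕ} (G : EdgeQuadrature M k Q) where
  edgeWeight : (K : ι) → Fin (M.cell K).numEdges → Fin Q → ℝ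
  edgeWeight_pos : ∀ K j q, 0 < edgeWeight K j q
  numInner : ι → ℕ
  innerWeight : (K : ι) → Fin (numInner K) → ℝ
  innerWeight_pos : ∀ K q, 0 < innerWeight K q
  innerNode : (K : ι) → Fin (numInner K) → Plane
  innerNode_mem : ∀ K q, innerNode K q ∈ (M.cell K).region
  exact_of_degree_le : ∀ K (u : MvPolynomial (Fin 2) ℝ), u.totalDegree ≤ k →
    (M.cell K).area⁻¹ * ∫ x in (M.cell K).region, evalAt u x
      = ∑ j, ∑ q, edgeWeight K j q * evalAt u (G.node K j q)
        + ∑ q, innerWeight K q * evalAt u (innerNode K q)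

/-- The set of all nodes of the special quadrature in the cell `K`. -/
def CellQuadrature.points {M : PolygonalMesh ι} {k Q : ℕ} {G : EdgeQuadrature M k Q}
    (C : CellQuadrature G) (K : ι) : Set Plane :=
  Set.range (C.innerNode K) ∪ ⋃ j, Set.range (G.node K j)

/-! ### The scheme for the cell averages -/

/-- States prescribed on the outer side of the edge nodes. They are used only at the edges on the
boundary of the domain. -/
abbrev BoundaryData (M : PolygonalMesh ι) (Q : ℕ) :=
  (K : ι) → Fin (M.cell K).numEdges → Fin Q → State

section Scheme

variable {M : PolygonalMesh ι} {k Q : ℕ} (eos : EOS) (σ : HLLSpeeds) (G : EdgeQuadrature M k Q)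
  (bd : BoundaryData M Q) (P : ι → Fin 8 → MvPolynomial (Fin 2) ℝ)

/-- The limit at an edge node, from the interior of `K`, of the piecewise polynomial `P`. -/
def intState (K : ι) (j : Fin (M.cell K).numEdges) (q : Fin Q) : State :=
  stateAt (P K) (G.node K j q)

/-- The limit at an edge node from the exterior of `K`: the value of the polynomial of the
adjacent cell, or the boundary datum if the edge lies on the boundary of the domain. -/
def extState (K : ι) (j : Fin (M.cell K).numEdges) (q : Fin Q) : State :=
  match M.neighbor K j with
  | some L => stateAt (P L) (G.node K j q)
  | none => bd K j q

/-- `σ⁻` at an edge node. -/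
def sigmaMinus (K : ι) (j : Fin (M.cell K).numEdges) (q : Fin Q) : ℝ :=
  σ.minus (intState G P K j q) (extState G bd P K j q) ((M.cell K).normal j)

/-- The upwind factor `η_K` at an edge node. -/
def eta (K : ι) (j : Fin (M.cell K).numEdges) (q : Fin Q) : ℝ :=
  upwindFactor σ (intState G P K j q) (extState G bd P K j q) ((M.cell K).normal j)

/-- The spatial discretization `L_K`, with the HLL flux and the upwind penalty term discretizing
the Godunov--Powell source. -/
def spatialOperator (K : ι) : State :=
  -((M.cell K).area⁻¹ • ∑ j, ∑ q, ((M.cell K).edgeLength j * G.weight q) •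
    (hllFlux eos σ (intState G P K j q) (extState G bd P K j q) ((M.cell K).normal j)
      - (eta σ G bd P K j q
          * pair ((M.cell K).normal j)
              (mag (extState G bd P K j q) - mag (intState G P K j q)))
        • source (intState G P K j q)))

/-- The interior wave speed bound `α̂` at an edge node. -/
def alphaHat (K : ι) (j : Fin (M.cell K).numEdges) (q : Fin Q) : ℝ :=
  speedC eos (intState G P K j q) ((M.cell K).normal j)
  + 2 / (M.cell K).perimeter
      * ∑ i, (M.cell K).edgeLength i * magJump (intState G P K j q) (intState G P K i q)
  + max (pair ((M.cell K).normal j) (vel (intState G P K j q)))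
      (1 / (M.cell K).perimeter
        * ∑ i, (M.cell K).edgeLength i
            * pair ((M.cell K).normal j - (M.cell K).normal i)
                (roeVel (intState G P K j q) (intState G P K i q)))

/-- The speed `α` of the CFL condition at an edge node. -/
def alphaCFL (K : ι) (j : Fin (M.cell K).numEdges) (q : Fin Q) : ℝ :=
  alphaHat eos G P K j q - sigmaMinus σ G bd P K j q
  - eta σ G bd P K j q * (√(rho (intState G P K j q)))⁻¹
      * |pair ((M.cell K).normal j)
          (mag (intState G P K j q) - mag (extState G bd P K j q))|

end Scheme

end MHD

end

open MHD

/-!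
The set of admissible states is described by linear inequalities: a state `U` of positive density
has positive internal energy as soon as the relative energy
`relEnergy u b U = ρ |v - u|² / 2 + |B - b|² / 2 + ρ e` is positive for all vectors `u`, `b`, and
this relative energy is an *affine* function of `U` (`relEnergy_eq`,
`mem_admissible_of_relEnergy_pos`). It therefore suffices to follow the density and, for fixed `u`
and `b`, the relative energy through the scheme.

By the cell quadrature, the relative energy of a cell average is a convex combination of relative
energies at the nodes, so the update stays positive if the boundary fluxes are bounded by the speed
`alphaCFL` times the relative energy at the edge nodes (`affine_update_pos`). Up to a constant and
a term linear in the normal magnetic field, the energy flux has three parts (`relFlux`): the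
kinetic and internal energies move with the velocity of the state, the pressure and magnetic stress
give a quadratic form bounded by the fast magnetosonic speed (`acousticFlux_le`), and the magnetic
part of the relative energy moves with `u`. The last part is cubic and has no bound by itself. In the
difference of the fluxes of two states, `u` can be replaced by an average velocity of these states,
with an error `magJump` times the relative energies (`pair_mul_sub_le`). This is used twice.

* At an interface, the HLL flux is the interior flux plus an upwind multiple of a difference of two
  fluxes, which the wave speed condition bounds. What remains is `u · b` times the jump of the
  normal magnetic field, which the Godunov-Powell source cancels, up to a term bounded by `ρ^(-1/2)`
  times the relative energy (`dualForm_hllFlux_sub_source_le`).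
* Along the boundary of a cell, the interior fluxes are summed. As the length-weighted normals of a
  polygon sum to zero, the sum can be written over pairs of edges and involves only differences
  (`sum_relFlux_le`). The term linear in the magnetic field is the discrete flux of a divergence-free
  polynomial field, exactly integrated by the quadrature. It vanishes because such a field has a
  stream function, whose differences along the edges telescope
  (`PolygonalCell.sum_integral_flux_eq_zero`).
-/

namespace MHD

/-! ### Planar normals and three-component vectors -/

/-- A planar vector as a three-component vector with vanishing last component. -/
noncomputable def planarVec (ξ : Plane) : Vec3 := !₂[ξ 0, ξ 1, 0]

lemma pair_eq_inner (ξ : Plane) (w : Vec3) : pair ξ w = inner ℝ (planarVec ξ) w := by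
  simp [pair, planarVec, PiLp.inner_apply, Fin.sum_univ_three]
  ring

lemma norm_planarVec (ξ : Plane) : ‖planarVec ξ‖ = ‖ξ‖ := by
  simp [EuclideanSpace.norm_eq, planarVec, Fin.sum_univ_three]

lemma pair_apply (ξ : Plane) (w : Vec3) : pair ξ w = ξ 0 * w 0 + ξ 1 * w 1 := by
  simp [pair]

lemma pair_le (ξ : Plane) (w : Vec3) : pair ξ w ≤ ‖ξ‖ * ‖w‖ := by
  rw [pair_eq_inner, ← norm_planarVec]
  exact real_inner_le_norm _ _

lemma pair_sub (ξ : Plane) (v w : Vec3) : pair ξ (v - w) = pair ξ v - pair ξ w := by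
  simp only [pair_eq_inner, inner_sub_right]

lemma pair_smul (ξ : Plane) (c : ℝ) (w : Vec3) : pair ξ (c • w) = c * pair ξ w := by
  simp only [pair_eq_inner, inner_smul_right]

lemma pair_neg_left (ξ : Plane) (w : Vec3) : pair (-ξ) w = -pair ξ w := by
  simp [pair_apply]; ring

lemma pair_sub_left (ξ ζ : Plane) (w : Vec3) : pair (ξ - ζ) w = pair ξ w - pair ζ w := by
  simp [pair_apply]; ring

/-! ### The relative energy, an affine functional -/

/-- The linear part `U ↦ U · (|u|² / 2, -u, -b, 1)` of the relative energy. -/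
noncomputable def dualForm (u b : Vec3) : State →ₗ[ℝ] ℝ where
  toFun U := U 0 * (‖u‖ ^ 2 / 2) - (u 0 * U 1 + u 1 * U 2 + u 2 * U 3)
    - (b 0 * U 4 + b 1 * U 5 + b 2 * U 6) + U 7
  map_add' U V := by simp only [Pi.add_apply]; ring
  map_smul' c U := by simp only [Pi.smul_apply, smul_eq_mul, RingHom.id_apply]; ring

/-- The energy of `U` relative to the velocity `u` and the magnetic field `b`. -/
noncomputable def relEnergy (u b : Vec3) (U : State) : ℝ := dualForm u b U + ‖b‖ ^ 2 / 2

lemma norm_sq_vec3 (w : Vec3) : ‖w‖ ^ 2 = w 0 ^ 2 + w 1 ^ 2 + w 2 ^ 2 := by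
  simp [EuclideanSpace.norm_sq_eq, Fin.sum_univ_three]

lemma inner_vec3 (v w : Vec3) : inner ℝ v w = v 0 * w 0 + v 1 * w 1 + v 2 * w 2 := by
  simp [PiLp.inner_apply, Fin.sum_univ_three]
  ring

lemma energy_eq {U : State} (hU : 0 < rho U) :
    energy U = internalEnergy U + (rho U * ‖vel U‖ ^ 2 + ‖mag U‖ ^ 2) / 2 := by
  have h := hU.ne'
  rw [internalEnergy, vel, norm_smul, mul_pow, Real.norm_eq_abs, sq_abs]
  field_simp
  ring

lemma relEnergy_eq {U : State} (hU : 0 < rho U) (u b : Vec3) :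
    relEnergy u b U
      = rho U * ‖vel U - u‖ ^ 2 / 2 + ‖mag U - b‖ ^ 2 / 2 + internalEnergy U := by
  have h := hU.ne'
  have hE := energy_eq hU
  simp only [norm_sq_vec3, vel, mom, mag, energy, relEnergy, dualForm, LinearMap.coe_mk,
    AddHom.coe_mk, PiLp.sub_apply, PiLp.smul_apply, smul_eq_mul] at hE ⊢
  simp only [rho] at *
  simp at hE ⊢
  rw [hE]
  field_simp
  ring

lemma relEnergy_pos {U : State} (hU : U ∈ admissible) (u b : Vec3) : 0 < relEnergy u b U := by
  rw [relEnergy_eq hU.1]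
  have := hU.1
  have := hU.2
  positivity

/-- Positivity of the internal energy follows from that of the affine functionals `relEnergy u b`:
at `u = vel U`, `b = mag U` the relative energy is the internal energy. -/
lemma mem_admissible_of_relEnergy_pos {U : State} (hρ : 0 < rho U)
    (h : ∀ u b, 0 < relEnergy u b U) : U ∈ admissible := by
  refine ⟨hρ, ?_⟩
  simpa [relEnergy_eq hρ] using h (vel U) (mag U)

lemma dualForm_source (u b : Vec3) (U : State) :
    dualForm u b (source U)
      = inner ℝ (vel U - u) (mag U - b) - inner ℝ u b := by
  simp only [inner_vec3, dualForm, LinearMap.coe_mk, AddHom.coe_mk, PiLp.sub_apply]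
  simp [source, mkState, inner_vec3]
  ring

/-- The part of the energy flux relative to `(u, b)` that is not carried along by a velocity:
the work of the pressure and of the magnetic stress. -/
noncomputable def acousticFlux (eos : EOS) (u b : Vec3) (ξ : Plane) (U : State) : ℝ :=
  pressure eos U * pair ξ (vel U - u) + pair ξ (vel U - u) * inner ℝ (mag U) (mag U - b)
    - pair ξ (mag U) * inner ℝ (vel U - u) (mag U - b)

/-- The energy flux relative to `(u, b)`. The kinetic and internal parts of the relative energy are
carried along by the velocity of the state, but the magnetic part by `u`. -/
noncomputable def relFlux (eos : EOS) (u b : Vec3) (ξ : Plane) (U : State) : ℝ :=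
  pair ξ (vel U) * (rho U * ‖vel U - u‖ ^ 2 / 2 + internalEnergy U)
    + pair ξ u * (‖mag U - b‖ ^ 2 / 2) + acousticFlux eos u b ξ U

/-- The dual form of the flux is the relative flux, up to a term which does not depend on the state
and one which is linear in the normal magnetic field. -/
lemma dualForm_normalFlux_eq (eos : EOS) {U : State} (hU : 0 < rho U) (u b : Vec3) (ξ : Plane) :
    dualForm u b (normalFlux eos ξ U)
      = relFlux eos u b ξ U - pair ξ u * (‖b‖ ^ 2 / 2) + pair ξ (mag U) * inner ℝ u b := by
  have hE := energy_eq hU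
  simp only [relFlux, acousticFlux, normalFlux, Fin.sum_univ_two, map_add, map_smul, smul_eq_mul,
    pair_apply, inner_vec3, dualForm, LinearMap.coe_mk, AddHom.coe_mk, PiLp.sub_apply,
    norm_sq_vec3] at hE ⊢
  simp [flux, mkState, inner_vec3, totalPressure, norm_sq_vec3, hE]
  ring

lemma rho_normalFlux (eos : EOS) (ξ : Plane) (U : State) :
    rho (normalFlux eos ξ U) = rho U * pair ξ (vel U) := by
  simp [rho, normalFlux, flux, mkState, pair_apply]
  ring

/-! ### The fast magnetosonic bound -/

section InnerProduct

variable {V : Type*} [NormedAddCommGroup V] [InnerProductSpace ℝ V]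

/-- `l` is the larger eigenvalue of the symmetric matrix with rows `(A, E)` and `(E, D)`. -/
lemma quadratic_form_le {A D E l s t : ℝ} (hA : A ≤ l) (hD : D ≤ l)
    (h : (l - A) * (l - D) = E ^ 2) :
    A * t ^ 2 + 2 * E * (t * s) + D * s ^ 2 ≤ l * (t ^ 2 + s ^ 2) := by
  have hA' : 0 ≤ l - A := by linarith
  have hD' : 0 ≤ l - D := by linarith
  rcases hA'.eq_or_lt with h0 | h0
  · have hE : E = 0 := by
      rw [← h0, zero_mul] at h
      exact pow_eq_zero_iff (two_ne_zero) |>.1 h.symm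
    subst hE
    nlinarith [mul_nonneg hA' (sq_nonneg t), mul_nonneg hD' (sq_nonneg s)]
  · have : 0 ≤ (l - A) * (l * (t ^ 2 + s ^ 2) - (A * t ^ 2 + 2 * E * (t * s) + D * s ^ 2)) := by
      have : (l - A) * (l * (t ^ 2 + s ^ 2) - (A * t ^ 2 + 2 * E * (t * s) + D * s ^ 2))
          = ((l - A) * t - E * s) ^ 2 := by linear_combination s ^ 2 * h
      rw [this]; positivity
    have := nonneg_of_mul_nonneg_right this h0
    linarith

/-- The map `x ↦ (C ⟪ξ, x⟫, ⟪ξ, x⟫ β - ⟪ξ, β⟫ x)` has squared norm at most `l`, the larger root of the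
characteristic polynomial of magnetosonic waves. Splitting `x` and `β` along `ξ` and orthogonally
to it reduces this to a symmetric matrix of size two. -/
lemma magnetosonic_operator_bound {ξ β x : V} (hξ : ‖ξ‖ = 1) {C l : ℝ}
    (hl : C ^ 2 + ‖β‖ ^ 2 ≤ 2 * l)
    (hroot : l ^ 2 - (C ^ 2 + ‖β‖ ^ 2) * l + C ^ 2 * inner ℝ ξ β ^ 2 = 0) :
    (C * inner ℝ ξ x) ^ 2 + ‖inner ℝ ξ x • β - inner ℝ ξ β • x‖ ^ 2 ≤ l * ‖x‖ ^ 2 := by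
  set t : ℝ := inner ℝ ξ x with ht
  set f : ℝ := inner ℝ ξ β with hf
  set x' := x - t • ξ with hx'
  set β' := β - f • ξ with hβ'
  have hξξ : (inner ℝ ξ ξ : ℝ) = 1 := by rw [real_inner_self_eq_norm_sq, hξ]; norm_num
  have hx0 : (inner ℝ ξ x' : ℝ) = 0 := by
    rw [hx', inner_sub_right, inner_smul_right, hξξ, ← ht]; ring
  have hβ0 : (inner ℝ ξ β' : ℝ) = 0 := by
    rw [hβ', inner_sub_right, inner_smul_right, hξξ, ← hf]; ring
  have key : ∀ (y : V) (c : ℝ), inner ℝ ξ y = (0 : ℝ) → ‖y + c • ξ‖ ^ 2 = c ^ 2 + ‖y‖ ^ 2 := by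
    intro y c hy
    rw [norm_add_sq_real, inner_smul_right, real_inner_comm, hy, norm_smul, hξ,
      Real.norm_eq_abs, mul_one, sq_abs]
    ring
  have hxn : ‖x‖ ^ 2 = t ^ 2 + ‖x'‖ ^ 2 := by
    rw [← key x' t hx0, hx', sub_add_cancel]
  have hβn : ‖β‖ ^ 2 = f ^ 2 + ‖β'‖ ^ 2 := by
    rw [← key β' f hβ0, hβ', sub_add_cancel]
  have hu : t • β - f • x = t • β' - f • x' := by
    rw [hx', hβ']; module
  have hun : ‖t • β - f • x‖ ^ 2 ≤ (|t| * ‖β'‖ + |f| * ‖x'‖) ^ 2 := by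
    rw [hu]
    gcongr
    exact (norm_sub_le _ _).trans (by simp [norm_smul])
  rw [hβn] at hl hroot
  have hprod : (l - (C ^ 2 + ‖β'‖ ^ 2)) * (l - f ^ 2) = (|f| * ‖β'‖) ^ 2 := by
    rw [mul_pow, sq_abs]; linear_combination hroot
  -- The factors of the nonnegative product have a nonnegative sum, so both are nonnegative.
  have hnn : 0 ≤ (l - (C ^ 2 + ‖β'‖ ^ 2)) * (l - f ^ 2) := by rw [hprod]; positivity
  have h12 : C ^ 2 + ‖β'‖ ^ 2 ≤ l ∧ f ^ 2 ≤ l := by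
    rcases mul_nonneg_iff.1 hnn with ⟨h1, h2⟩ | ⟨h1, h2⟩ <;> constructor <;> linarith
  have := quadratic_form_le (t := |t|) (s := ‖x'‖) h12.1 h12.2 hprod
  rw [hxn]
  rw [sq_abs] at this
  calc _ ≤ (C * t) ^ 2 + (|t| * ‖β'‖ + |f| * ‖x'‖) ^ 2 := by gcongr
    _ = (C ^ 2 + ‖β'‖ ^ 2) * t ^ 2 + 2 * (|f| * ‖β'‖) * (|t| * ‖x'‖) + f ^ 2 * ‖x'‖ ^ 2 := by
        rw [add_sq, mul_pow, mul_pow |t|, mul_pow |f|, sq_abs, sq_abs]; ring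
    _ ≤ _ := this

/-- The bilinear form of the acoustic flux in the rescaled variables: `x` is the relative velocity
times `√ρ`, `y` the relative magnetic field, `z² / 2` the internal energy, `β` the Alfvén velocity
`B / √ρ` and `C` the sound speed. -/
lemma magnetosonic_form_bound {ξ β x y : V} (hξ : ‖ξ‖ = 1) {C z c : ℝ} (hc : 0 ≤ c)
    (hl : C ^ 2 + ‖β‖ ^ 2 ≤ 2 * c ^ 2)
    (hroot : (c ^ 2) ^ 2 - (C ^ 2 + ‖β‖ ^ 2) * c ^ 2 + C ^ 2 * inner ℝ ξ β ^ 2 = 0) :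
    C * z * inner ℝ ξ x + inner ℝ ξ x * inner ℝ β y - inner ℝ ξ β * inner ℝ x y
      ≤ c * ((‖x‖ ^ 2 + ‖y‖ ^ 2 + z ^ 2) / 2) := by
  have hN := magnetosonic_operator_bound (x := x) hξ hl hroot
  set p : ℝ := C * inner ℝ ξ x with hp
  set w : V := inner ℝ ξ x • β - inner ℝ ξ β • x with hw
  have hform : C * z * inner ℝ ξ x + inner ℝ ξ x * inner ℝ β y - inner ℝ ξ β * inner ℝ x y
      = p * z + inner ℝ w y := by
    rw [hw, inner_sub_left, real_inner_smul_left, real_inner_smul_left]; ring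
  rw [hform]
  have hwy : inner ℝ w y ≤ ‖w‖ * ‖y‖ := real_inner_le_norm _ _
  rcases hc.eq_or_lt with h0 | h0
  · subst h0
    have hp0 : p = 0 := by nlinarith [sq_nonneg p, sq_nonneg ‖w‖]
    have hw0 : ‖w‖ = 0 := by nlinarith [sq_nonneg p, sq_nonneg ‖w‖]
    rw [hw0] at hwy
    rw [hp0]
    linarith
  · refine le_of_mul_le_mul_left ?_ h0
    nlinarith [sq_nonneg (p - c * z), sq_nonneg (‖w‖ - c * ‖y‖)]

end InnerProduct

lemma speedC_nonneg (eos : EOS) (U : State) (ξ : Plane) : 0 ≤ speedC eos U ξ := by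
  unfold speedC; positivity

lemma speedC_neg (eos : EOS) (U : State) (ξ : Plane) : speedC eos U (-ξ) = speedC eos U ξ := by
  simp [speedC, pair_neg_left]

/-- The square of `speedC` is the larger root of the magnetosonic polynomial. -/
lemma speedC_sq {U : State} (hU : 0 < rho U) (eos : EOS) {ξ : Plane} (hξ : ‖ξ‖ = 1) :
    soundC eos U ^ 2 + ‖mag U‖ ^ 2 / rho U ≤ 2 * speedC eos U ξ ^ 2 ∧
    (speedC eos U ξ ^ 2) ^ 2 - (soundC eos U ^ 2 + ‖mag U‖ ^ 2 / rho U) * speedC eos U ξ ^ 2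
      + soundC eos U ^ 2 * (pair ξ (mag U) ^ 2 / rho U) = 0 := by
  set C := soundC eos U with hC
  set a := C ^ 2 + ‖mag U‖ ^ 2 / rho U with ha
  set d := a ^ 2 - 4 * (C ^ 2 * pair ξ (mag U) ^ 2 / rho U) with hd
  have hpair : pair ξ (mag U) ^ 2 ≤ ‖mag U‖ ^ 2 := by
    have h1 := pair_le ξ (mag U)
    have h2 := pair_le (-ξ) (mag U)
    rw [pair_neg_left, norm_neg] at h2
    rw [hξ, one_mul] at h1 h2
    exact sq_le_sq' (by linarith) h1
  -- By the bound on the normal field, the discriminant is at least a square.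
  have hd0 : 0 ≤ d := by
    have h1 : C ^ 2 * pair ξ (mag U) ^ 2 / rho U ≤ C ^ 2 * ‖mag U‖ ^ 2 / rho U := by gcongr
    have h2 : a ^ 2 - 4 * (C ^ 2 * ‖mag U‖ ^ 2 / rho U) = (C ^ 2 - ‖mag U‖ ^ 2 / rho U) ^ 2 := by
      rw [ha]; ring
    nlinarith [sq_nonneg (C ^ 2 - ‖mag U‖ ^ 2 / rho U)]
  have ha0 : 0 ≤ a := by rw [ha]; positivity
  have hs : speedC eos U ξ ^ 2 = (a + √d) / 2 := by
    rw [speedC, mul_pow, div_pow, Real.sq_sqrt (by norm_num : (0 : ℝ) ≤ 2), ← hC, ← ha, ← hd,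
      Real.sq_sqrt (by positivity)]
    ring
  have hsd := Real.sq_sqrt hd0
  rw [hs]
  refine ⟨by linarith [Real.sqrt_nonneg d], ?_⟩
  have : C ^ 2 * (pair ξ (mag U) ^ 2 / rho U) = (a ^ 2 - d) / 4 := by rw [hd]; ring
  rw [this]
  linear_combination hsd / 4

/-- The acoustic flux is bounded by the fast magnetosonic speed times the relative energy. -/
lemma acousticFlux_le (eos : EOS) {U : State} (hU : U ∈ admissible) (u b : Vec3) {ξ : Plane}
    (hξ : ‖ξ‖ = 1) : acousticFlux eos u b ξ U ≤ speedC eos U ξ * relEnergy u b U := by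
  have hρ := hU.1
  have hr : 0 < √(rho U) := Real.sqrt_pos.2 hρ
  have hr2 : √(rho U) ^ 2 = rho U := Real.sq_sqrt hρ.le
  have he : 0 < specificEnergy U := div_pos hU.2 hρ
  have hie : rho U * specificEnergy U = internalEnergy U := by
    rw [specificEnergy]; field_simp
  have hs : 0 < √(2 * specificEnergy U) := Real.sqrt_pos.2 (by positivity)
  have hs2 : √(2 * specificEnergy U) ^ 2 = 2 * specificEnergy U := Real.sq_sqrt (by positivity)
  obtain ⟨h1, h2⟩ := speedC_sq hρ eos hξ
  have hβ : ‖(√(rho U))⁻¹ • mag U‖ ^ 2 = ‖mag U‖ ^ 2 / rho U := by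
    rw [norm_smul, mul_pow, norm_inv, inv_pow, Real.norm_eq_abs, sq_abs, hr2]; ring
  have hβ' : (inner ℝ (planarVec ξ) ((√(rho U))⁻¹ • mag U)) ^ 2 = pair ξ (mag U) ^ 2 / rho U := by
    rw [inner_smul_right, mul_pow, inv_pow, hr2, ← pair_eq_inner]; ring
  have := magnetosonic_form_bound (ξ := planarVec ξ) (β := (√(rho U))⁻¹ • mag U)
    (x := √(rho U) • (vel U - u)) (y := mag U - b) (C := soundC eos U)
    (z := √(rho U) * √(2 * specificEnergy U)) (by rw [norm_planarVec, hξ])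
    (speedC_nonneg eos U ξ) (by rw [hβ]; exact h1) (by rw [hβ, hβ']; exact h2)
  have hen : (‖√(rho U) • (vel U - u)‖ ^ 2 + ‖mag U - b‖ ^ 2
      + (√(rho U) * √(2 * specificEnergy U)) ^ 2) / 2 = relEnergy u b U := by
    rw [relEnergy_eq hρ, norm_smul, mul_pow, mul_pow, hr2, hs2, Real.norm_eq_abs, sq_abs, hr2,
      ← hie]
    ring
  rw [hen] at this
  refine le_of_eq_of_le ?_ this
  simp only [inner_smul_right, real_inner_smul_left, ← pair_eq_inner, acousticFlux, soundC]
  field_simp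
  rw [hr2]
  ring

/-! ### Differences of energy fluxes -/

lemma roeVel_comm (U U' : State) : roeVel U U' = roeVel U' U := by
  simp only [roeVel, add_comm]

lemma magJump_comm (U U' : State) : magJump U U' = magJump U' U := by
  simp only [magJump, add_comm, norm_sub_rev]

lemma magJump_nonneg (U U' : State) : 0 ≤ magJump U U' := by
  unfold magJump; positivity

/-- The velocity `u` in the difference of the magnetic energies relative to `b` can be traded for
the average velocity of the two states, at the price of `magJump` times the relative energies. -/
lemma pair_mul_sub_le {U U' : State} (hU : U ∈ admissible) (hU' : U' ∈ admissible)
    (u b : Vec3) (ξ : Plane) :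
    pair ξ u * (‖mag U - b‖ ^ 2 / 2 - ‖mag U' - b‖ ^ 2 / 2)
      ≤ pair ξ (roeVel U U') * (‖mag U - b‖ ^ 2 / 2 - ‖mag U' - b‖ ^ 2 / 2)
        + ‖ξ‖ * magJump U U' * (relEnergy u b U + relEnergy u b U') := by
  have hr : 0 < √(rho U) := Real.sqrt_pos.2 hU.1
  have hr' : 0 < √(rho U') := Real.sqrt_pos.2 hU'.1
  have hr2 : √(rho U) ^ 2 = rho U := Real.sq_sqrt hU.1.le
  have hr2' : √(rho U') ^ 2 = rho U' := Real.sq_sqrt hU'.1.le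
  have hg := relEnergy_eq hU.1 u b
  have hg' := relEnergy_eq hU'.1 u b
  have hi := hU.2
  have hi' := hU'.2
  set r := √(rho U)
  set r' := √(rho U')
  set w := vel U - u with hw
  set w' := vel U' - u with hw'
  set D := mag U - b with hD
  set D' := mag U' - b with hD'
  set s : Vec3 := r • w + r' • w' with hs
  have hroe : u = roeVel U U' - (r + r')⁻¹ • s := by
    rw [roeVel, hs, hw, hw', ← smul_sub]
    have : r • vel U + r' • vel U' - (r • (vel U - u) + r' • (vel U' - u)) = (r + r') • u := by
      module
    rw [this, smul_smul, inv_mul_cancel₀ (by positivity), one_smul]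
  have hdiff : ‖D‖ ^ 2 - ‖D'‖ ^ 2 = inner ℝ (D - D') (D + D') := by
    rw [inner_sub_left, inner_add_right, inner_add_right, real_inner_self_eq_norm_sq,
      real_inner_self_eq_norm_sq, real_inner_comm D' D]
    ring
  have hDD : D - D' = mag U - mag U' := by rw [hD, hD']; abel
  have habs : |‖D‖ ^ 2 - ‖D'‖ ^ 2| ≤ ‖mag U - mag U'‖ * (‖D‖ + ‖D'‖) := by
    rw [hdiff, ← hDD]
    exact (abs_real_inner_le_norm _ _).trans (by gcongr; exact norm_add_le _ _)
  have hsn : ‖s‖ ≤ r * ‖w‖ + r' * ‖w'‖ := by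
    refine (norm_add_le _ _).trans (le_of_eq ?_)
    rw [norm_smul, norm_smul, Real.norm_of_nonneg hr.le, Real.norm_of_nonneg hr'.le]
  have hps : |pair ξ s| ≤ ‖ξ‖ * (r * ‖w‖ + r' * ‖w'‖) := by
    rw [pair_eq_inner, ← norm_planarVec]
    exact (abs_real_inner_le_norm _ _).trans (by gcongr)
  have hyoung : (r * ‖w‖ + r' * ‖w'‖) * (‖D‖ + ‖D'‖)
      ≤ 2 * (relEnergy u b U + relEnergy u b U') := by
    rw [hg, hg', ← hr2, ← hr2']
    nlinarith [sq_nonneg (r * ‖w‖ + r' * ‖w'‖ - (‖D‖ + ‖D'‖)), sq_nonneg (r * ‖w‖ - r' * ‖w'‖),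
      sq_nonneg (‖D‖ - ‖D'‖)]
  have herr : -(pair ξ s * (‖D‖ ^ 2 - ‖D'‖ ^ 2))
      ≤ ‖ξ‖ * ‖mag U - mag U'‖ * (2 * (relEnergy u b U + relEnergy u b U')) := by
    calc -(pair ξ s * (‖D‖ ^ 2 - ‖D'‖ ^ 2)) ≤ |pair ξ s| * |‖D‖ ^ 2 - ‖D'‖ ^ 2| := by
          rw [← abs_mul]; exact neg_le_abs _
      _ ≤ (‖ξ‖ * (r * ‖w‖ + r' * ‖w'‖)) * (‖mag U - mag U'‖ * (‖D‖ + ‖D'‖)) := by gcongr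
      _ = ‖ξ‖ * ‖mag U - mag U'‖ * ((r * ‖w‖ + r' * ‖w'‖) * (‖D‖ + ‖D'‖)) := by ring
      _ ≤ _ := by gcongr
  have hu : pair ξ u = pair ξ (roeVel U U') - (r + r')⁻¹ * pair ξ s := by
    conv_lhs => rw [hroe]
    rw [pair_sub, pair_smul]
  have hscaled := mul_le_mul_of_nonneg_left herr (by positivity : 0 ≤ (r + r')⁻¹ / 2)
  have hjump : magJump U U' = (r + r')⁻¹ * ‖mag U - mag U'‖ := by
    rw [magJump, div_eq_inv_mul]
  rw [hu, hjump]
  linarith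

lemma acousticFlux_neg (eos : EOS) (u b : Vec3) (ξ : Plane) (U : State) :
    acousticFlux eos u b (-ξ) U = -acousticFlux eos u b ξ U := by
  simp only [acousticFlux, pair_neg_left]; ring

/-- A weighted mean of the speeds `x` and `y` of the two parts of the relative energy is bounded
by their maximum. -/
lemma mul_add_mul_le_max_mul {U : State} (hU : U ∈ admissible) (u b : Vec3) (x y : ℝ) :
    x * (rho U * ‖vel U - u‖ ^ 2 / 2 + internalEnergy U) + y * (‖mag U - b‖ ^ 2 / 2)
      ≤ max x y * relEnergy u b U := by
  have hρ := hU.1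
  have hi := hU.2
  rw [relEnergy_eq hU.1]
  have h1 : x * (rho U * ‖vel U - u‖ ^ 2 / 2 + internalEnergy U)
      ≤ max x y * (rho U * ‖vel U - u‖ ^ 2 / 2 + internalEnergy U) := by
    gcongr
    exact le_max_left _ _
  have h2 : y * (‖mag U - b‖ ^ 2 / 2) ≤ max x y * (‖mag U - b‖ ^ 2 / 2) := by
    gcongr
    exact le_max_right _ _
  linarith

/-- The cubic terms `pair ξ u * ‖mag U - b‖ ^ 2 / 2`, which no multiple of a single relative energy
bounds uniformly in `u`, are controlled in the difference of two fluxes. -/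
lemma relFlux_sub_le (eos : EOS) {U U' : State} (hU : U ∈ admissible) (hU' : U' ∈ admissible)
    (u b : Vec3) {ξ : Plane} (hξ : ‖ξ‖ = 1) :
    relFlux eos u b ξ U - relFlux eos u b ξ U'
      ≤ alphaR eos U U' ξ * relEnergy u b U - alphaL eos U' U ξ * relEnergy u b U' := by
  have h1 := pair_mul_sub_le hU hU' u b ξ
  have h2 := acousticFlux_le eos hU u b hξ
  have h3 := acousticFlux_le eos hU' u b (ξ := -ξ) (by rw [norm_neg, hξ])
  rw [acousticFlux_neg, speedC_neg] at h3
  have h4 := mul_add_mul_le_max_mul hU u b (pair ξ (vel U)) (pair ξ (roeVel U U'))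
  have h5 := mul_add_mul_le_max_mul hU' u b (-pair ξ (vel U')) (-pair ξ (roeVel U U'))
  rw [max_neg_neg] at h5
  rw [hξ, one_mul] at h1
  rw [relFlux, relFlux, alphaR, alphaL, roeVel_comm U' U, magJump_comm U' U]
  linarith

/-! ### One interface -/

section Interface

variable {eos : EOS} {σ : HLLSpeeds} {U U' : State} {ξ : Plane}

lemma HLLSpeeds.plus_sub_minus_pos (hU : U ∈ admissible) (hU' : U' ∈ admissible)
    (hξ : ‖ξ‖ = 1) : 0 < σ.plus U U' ξ - σ.minus U U' ξ := by
  have h := σ.left_lt_right U hU U' hU' ξ hξ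
  have h1 : σ.right U U' ξ ≤ σ.plus U U' ξ := le_max_left _ _
  have h2 : σ.minus U U' ξ ≤ σ.left U U' ξ := min_le_left _ _
  linarith

lemma HLLSpeeds.minus_nonpos : σ.minus U U' ξ ≤ 0 := min_le_right _ _

lemma upwindFactor_nonpos (hU : U ∈ admissible) (hU' : U' ∈ admissible) (hξ : ‖ξ‖ = 1) :
    upwindFactor σ U U' ξ ≤ 0 :=
  div_nonpos_of_nonpos_of_nonneg HLLSpeeds.minus_nonpos
    (HLLSpeeds.plus_sub_minus_pos hU hU' hξ).le

/-- The HLL flux as the interior flux with an upwind correction, which is a nonnegative multiple of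
the jump of the flux minus `σ⁺` times the jump of the state. -/
lemma hllFlux_eq (hU : U ∈ admissible) (hU' : U' ∈ admissible) (hξ : ‖ξ‖ = 1) :
    hllFlux eos σ U U' ξ = normalFlux eos ξ U - upwindFactor σ U U' ξ •
      (normalFlux eos ξ U' - normalFlux eos ξ U - σ.plus U U' ξ • (U' - U)) := by
  have h := (HLLSpeeds.plus_sub_minus_pos (σ := σ) hU hU' hξ).ne'
  ext i
  simp only [hllFlux, upwindFactor, Pi.smul_apply, Pi.add_apply, Pi.sub_apply, smul_eq_mul]
  field_simp
  ring

lemma upwindFactor_mul (hU : U ∈ admissible) (hU' : U' ∈ admissible) (hξ : ‖ξ‖ = 1) :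
    upwindFactor σ U U' ξ * (σ.plus U U' ξ - σ.minus U U' ξ) = σ.minus U U' ξ :=
  div_mul_cancel₀ _ (HLLSpeeds.plus_sub_minus_pos hU hU' hξ).ne'

lemma inner_sub_sub_le {U : State} (hU : U ∈ admissible) (u b : Vec3) :
    |inner ℝ (vel U - u) (mag U - b)| ≤ (√(rho U))⁻¹ * relEnergy u b U := by
  have hr : 0 < √(rho U) := Real.sqrt_pos.2 hU.1
  have hr2 : √(rho U) ^ 2 = rho U := Real.sq_sqrt hU.1.le
  have hi := hU.2
  rw [← div_eq_inv_mul, le_div_iff₀ hr]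
  calc |inner ℝ (vel U - u) (mag U - b)| * √(rho U)
      ≤ (‖vel U - u‖ * ‖mag U - b‖) * √(rho U) := by
        gcongr
        exact abs_real_inner_le_norm _ _
    _ ≤ relEnergy u b U := by
        rw [relEnergy_eq hU.1]
        have h := sq_nonneg (√(rho U) * ‖vel U - u‖ - ‖mag U - b‖)
        rw [sub_sq, mul_pow, hr2] at h
        linarith

/-- The energy balance across one interface. The part of the flux jump that is proportional to the
jump of the normal magnetic field and has no sign is cancelled by the source term. -/
lemma dualForm_hllFlux_sub_source_le (hU : U ∈ admissible) (hU' : U' ∈ admissible)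
    (hξ : ‖ξ‖ = 1) (h : WaveSpeedCondition eos σ U U' ξ) (u b : Vec3) :
    dualForm u b (hllFlux eos σ U U' ξ
        - (upwindFactor σ U U' ξ * pair ξ (mag U' - mag U)) • source U)
      ≤ dualForm u b (normalFlux eos ξ U)
        + (-σ.minus U U' ξ
          - upwindFactor σ U U' ξ * (√(rho U))⁻¹ * |pair ξ (mag U - mag U')|)
          * relEnergy u b U := by
  have hη := upwindFactor_nonpos (σ := σ) hU hU' hξ
  have hmul := upwindFactor_mul (σ := σ) hU hU' hξ
  have hg := relEnergy_pos hU u b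
  have hg' := relEnergy_pos hU' u b
  have hR : alphaR eos U' U ξ ≤ σ.plus U U' ξ := h.1.trans (le_max_left _ _)
  have hL : σ.minus U U' ξ ≤ alphaL eos U U' ξ := (min_le_left _ _).trans h.2
  rw [hllFlux_eq hU hU' hξ]
  simp only [map_sub, map_smul, smul_eq_mul, dualForm_source]
  have hsub : dualForm u b U' - dualForm u b U = relEnergy u b U' - relEnergy u b U := by
    simp only [relEnergy]; ring
  rw [hsub]
  have hflux : dualForm u b (normalFlux eos ξ U') - dualForm u b (normalFlux eos ξ U)
      = relFlux eos u b ξ U' - relFlux eos u b ξ U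
        + pair ξ (mag U' - mag U) * inner ℝ u b := by
    rw [dualForm_normalFlux_eq eos hU.1, dualForm_normalFlux_eq eos hU'.1, pair_sub]; ring
  rw [hflux]
  have hrel := relFlux_sub_le eos hU' hU u b hξ
  have hrel' : relFlux eos u b ξ U' - relFlux eos u b ξ U
      ≤ σ.plus U U' ξ * relEnergy u b U' - σ.minus U U' ξ * relEnergy u b U := by
    refine hrel.trans ?_
    have := mul_le_mul_of_nonneg_right hR hg'.le
    have := mul_le_mul_of_nonneg_right hL hg.le
    linarith
  have hsrc : -(pair ξ (mag U' - mag U) * inner ℝ (vel U - u) (mag U - b))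
        ≥ -(|pair ξ (mag U - mag U')| * ((√(rho U))⁻¹ * relEnergy u b U)) := by
    have h1 : |pair ξ (mag U' - mag U)| = |pair ξ (mag U - mag U')| := by
      rw [pair_sub, pair_sub, abs_sub_comm]
    have h2 := le_abs_self (pair ξ (mag U' - mag U) * inner ℝ (vel U - u) (mag U - b))
    rw [abs_mul, h1] at h2
    have h3 := mul_le_mul_of_nonneg_left (inner_sub_sub_le hU u b)
      (abs_nonneg (pair ξ (mag U - mag U')))
    linarith
  have e1 := mul_le_mul_of_nonneg_left hrel' (neg_nonneg.2 hη)
  have e2 := mul_le_mul_of_nonneg_left hsrc (neg_nonneg.2 hη)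
  have e3 : upwindFactor σ U U' ξ * (σ.plus U U' ξ - σ.minus U U' ξ) * relEnergy u b U
    = σ.minus U U' ξ * relEnergy u b U := by rw [hmul]
  linarith

/-- The mass balance across one interface, in which the source plays no role. -/
lemma rho_hllFlux_le (hU : U ∈ admissible) (hU' : U' ∈ admissible)
    (hξ : ‖ξ‖ = 1) (h : WaveSpeedCondition eos σ U U' ξ) (c : ℝ) :
    rho (hllFlux eos σ U U' ξ - c • source U)
      ≤ pair ξ (vel U) * rho U - σ.minus U U' ξ * rho U := by
  have hη := upwindFactor_nonpos (σ := σ) hU hU' hξ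
  have hmul := upwindFactor_mul (σ := σ) hU hU' hξ
  have hR : pair ξ (vel U') ≤ σ.plus U U' ξ := by
    refine le_trans ?_ (h.1.trans (le_max_left _ _))
    have := le_max_left (pair ξ (vel U')) (pair ξ (roeVel U' U))
    have := speedC_nonneg eos U' ξ
    have := magJump_nonneg U' U
    rw [alphaR]; linarith
  have hL : σ.minus U U' ξ ≤ pair ξ (vel U) := by
    refine ((min_le_left _ _).trans h.2).trans ?_
    have := min_le_left (pair ξ (vel U)) (pair ξ (roeVel U U'))
    have := speedC_nonneg eos U ξ
    have := magJump_nonneg U U'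
    rw [alphaL]; linarith
  have hn := rho_normalFlux eos ξ U
  have hn' := rho_normalFlux eos ξ U'
  have hs : rho (source U) = 0 := by simp [rho, source, mkState]
  rw [hllFlux_eq hU hU' hξ]
  have hρ := hU.1
  have hρ' := hU'.1
  simp only [rho, Pi.sub_apply, Pi.smul_apply, smul_eq_mul] at *
  rw [hn, hn', hs]
  have h1 := mul_le_mul_of_nonneg_right hR hρ'.le
  have h2 := mul_le_mul_of_nonneg_right hL hρ.le
  have e1 := mul_nonneg (neg_nonneg.2 hη) (sub_nonneg.2 h1)
  have e2 := mul_nonneg (neg_nonneg.2 hη) (sub_nonneg.2 h2)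
  have e3 : upwindFactor σ U U' ξ * (σ.plus U U' ξ - σ.minus U U' ξ) * U 0
    = σ.minus U U' ξ * U 0 := by rw [hmul]
  linarith

end Interface

/-! ### Closed polygons and divergence-free fields -/

lemma sum_mul_pair_eq_zero {J : Type*} [Fintype J] {l : J → ℝ} {ξ : J → Plane}
    (h : ∑ j, l j • ξ j = 0) (u : Vec3) : ∑ j, l j * pair (ξ j) u = 0 := by
  have h0 := congrArg (fun v : Plane => v 0) h
  have h1 := congrArg (fun v : Plane => v 1) h
  simp at h0 h1
  simp only [pair_apply, mul_add, Finset.sum_add_distrib, ← mul_assoc, ← Finset.sum_mul]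
  rw [h0, h1]
  ring

/-- The sum over the edges of a closed polygon of the relative energy fluxes, one state per edge.
Since the weighted normals sum to zero, the sum can be symmetrized over pairs of edges, and the
velocity `u` replaced by average velocities. -/
lemma sum_relFlux_le (eos : EOS) {J : Type*} [Fintype J] (l : J → ℝ) (hl : ∀ j, 0 ≤ l j)
    (hL : 0 < ∑ j, l j) (ξ : J → Plane) (hξ : ∀ j, ‖ξ j‖ = 1) (hclosed : ∑ j, l j • ξ j = 0)
    (U : J → State) (hU : ∀ j, U j ∈ admissible) (u b : Vec3) :
    ∑ j, l j * relFlux eos u b (ξ j) (U j)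
      ≤ ∑ j, l j * ((speedC eos (U j) (ξ j)
          + 2 / (∑ i, l i) * ∑ i, l i * magJump (U j) (U i)
          + max (pair (ξ j) (vel (U j)))
            (1 / (∑ i, l i) * ∑ i, l i * pair (ξ j - ξ i) (roeVel (U j) (U i))))
          * relEnergy u b (U j)) := by
  set L := ∑ j, l j with hLdef
  set d : J → ℝ := fun j => ‖mag (U j) - b‖ ^ 2 / 2 with hd
  set g : J → ℝ := fun j => relEnergy u b (U j) with hg
  have hg0 : ∀ j, 0 < g j := fun j => relEnergy_pos (hU j) u b
  have hpair0 : ∑ i, l i * pair (ξ i) u = 0 := sum_mul_pair_eq_zero hclosed u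
  have hdouble : ∑ j, ∑ i, l j * l i * (pair (ξ j - ξ i) u * d j)
      = L * ∑ j, l j * (pair (ξ j) u * d j) := by
    have : ∀ j, ∑ i, l j * l i * (pair (ξ j - ξ i) u * d j)
        = L * (l j * (pair (ξ j) u * d j)) - l j * d j * ∑ i, l i * pair (ξ i) u := by
      intro j
      rw [hLdef, Finset.sum_mul, Finset.mul_sum, ← Finset.sum_sub_distrib]
      refine Finset.sum_congr rfl fun i _ => ?_
      rw [pair_sub_left]; ring
    simp only [this, hpair0, mul_zero, sub_zero, Finset.mul_sum]
  -- Symmetrization over pairs of edges, so that differences of magnetic energies appear.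
  have hswap : ∀ F : J → J → ℝ, 2 * ∑ j, ∑ i, F j i = ∑ j, ∑ i, (F j i + F i j) := by
    intro F
    simp only [Finset.sum_add_distrib]
    rw [Finset.sum_comm (f := fun j i => F i j)]
    ring
  have hpairwise : ∀ j i, l j * l i * (pair (ξ j - ξ i) u * d j)
        + l i * l j * (pair (ξ i - ξ j) u * d i)
      ≤ (l j * l i * (pair (ξ j - ξ i) (roeVel (U j) (U i)) * d j + 2 * magJump (U j) (U i) * g j))
        + (l i * l j * (pair (ξ i - ξ j) (roeVel (U i) (U j)) * d i
            + 2 * magJump (U i) (U j) * g i)) := by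
    intro j i
    have h1 := pair_mul_sub_le (hU j) (hU i) u b (ξ j - ξ i)
    have h2 : ‖ξ j - ξ i‖ * magJump (U j) (U i) * (g j + g i)
        ≤ 2 * magJump (U j) (U i) * (g j + g i) := by
      have := norm_sub_le (ξ j) (ξ i)
      rw [hξ, hξ] at this
      have := magJump_nonneg (U j) (U i)
      have := (hg0 j).le
      have := (hg0 i).le
      gcongr
      linarith
    have h3 := mul_le_mul_of_nonneg_left (h1.trans (add_le_add_right h2 _))
      (mul_nonneg (hl j) (hl i))
    rw [roeVel_comm (U i), magJump_comm (U i)]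
    simp only [pair_sub_left, hd] at h3 ⊢
    linarith
  have hmag : ∑ j, l j * (pair (ξ j) u * d j)
      ≤ ∑ j, l j * ((1 / L * ∑ i, l i * pair (ξ j - ξ i) (roeVel (U j) (U i))) * d j
        + (2 / L * ∑ i, l i * magJump (U j) (U i)) * g j) := by
    have h1 : 2 * (L * ∑ j, l j * (pair (ξ j) u * d j))
        ≤ 2 * ∑ j, ∑ i, l j * l i * (pair (ξ j - ξ i) (roeVel (U j) (U i)) * d j
          + 2 * magJump (U j) (U i) * g j) := by
      rw [← hdouble, hswap, hswap]
      exact Finset.sum_le_sum fun j _ => Finset.sum_le_sum fun i _ => hpairwise j i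
    have h2 : L * ∑ j, l j * ((1 / L * ∑ i, l i * pair (ξ j - ξ i) (roeVel (U j) (U i))) * d j
        + (2 / L * ∑ i, l i * magJump (U j) (U i)) * g j)
        = ∑ j, ∑ i, l j * l i * (pair (ξ j - ξ i) (roeVel (U j) (U i)) * d j
          + 2 * magJump (U j) (U i) * g j) := by
      rw [Finset.mul_sum]
      refine Finset.sum_congr rfl fun j _ => ?_
      have : ∀ i, l j * l i * (pair (ξ j - ξ i) (roeVel (U j) (U i)) * d j
          + 2 * magJump (U j) (U i) * g j)
          = (l i * pair (ξ j - ξ i) (roeVel (U j) (U i))) * (l j * d j)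
            + (l i * magJump (U j) (U i)) * (2 * l j * g j) := fun i => by ring
      simp only [this, Finset.sum_add_distrib, ← Finset.sum_mul]
      field_simp
    rw [← h2] at h1
    exact le_of_mul_le_mul_left (by linarith) hL
  have hsplit : ∀ j, l j * relFlux eos u b (ξ j) (U j)
      = l j * (pair (ξ j) (vel (U j)) * (rho (U j) * ‖vel (U j) - u‖ ^ 2 / 2
          + internalEnergy (U j)) + acousticFlux eos u b (ξ j) (U j))
        + l j * (pair (ξ j) u * d j) := by
    intro j; rw [relFlux]; ring
  simp only [hsplit, Finset.sum_add_distrib]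
  refine (add_le_add_right hmag _).trans ?_
  rw [← Finset.sum_add_distrib]
  refine Finset.sum_le_sum fun j _ => ?_
  rw [← mul_add]
  refine mul_le_mul_of_nonneg_left ?_ (hl j)
  have h1 := acousticFlux_le eos (hU j) u b (hξ j)
  have h2 := mul_add_mul_le_max_mul (hU j) u b (pair (ξ j) (vel (U j)))
    (1 / L * ∑ i, l i * pair (ξ j - ξ i) (roeVel (U j) (U i)))
  simp only [hd, hg]
  linarith

lemma continuous_evalAt (p : MvPolynomial (Fin 2) ℝ) : Continuous (evalAt p) :=
  (MvPolynomial.continuous_eval p).comp (by fun_prop)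

lemma hasFDerivAt_evalAt (p : MvPolynomial (Fin 2) ℝ) (x : Plane) :
    HasFDerivAt (evalAt p)
      (∑ i, evalAt (MvPolynomial.pderiv i p) x • (EuclideanSpace.proj i : Plane →L[ℝ] ℝ)) x := by
  induction p using MvPolynomial.induction_on with
  | C a =>
    have : evalAt (MvPolynomial.C a) = fun _ : Plane => a := by ext y; simp [evalAt]
    rw [this]
    simpa [evalAt] using hasFDerivAt_const a x
  | add p q hp hq =>
    have : evalAt (p + q) = fun y => evalAt p y + evalAt q y := by ext y; simp [evalAt]
    rw [this]
    refine (hp.add hq).congr_fderiv ?_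
    simp [evalAt, add_smul, Finset.sum_add_distrib]
  | mul_X p n hp =>
    have : evalAt (p * MvPolynomial.X n) = fun y => evalAt p y * y n := by ext y; simp [evalAt]
    rw [this]
    have hn : HasFDerivAt (fun y : Plane => y n) (EuclideanSpace.proj n : Plane →L[ℝ] ℝ) x :=
      (EuclideanSpace.proj n : Plane →L[ℝ] ℝ).hasFDerivAt
    refine (hp.mul hn).congr_fderiv ?_
    ext h
    fin_cases n <;>
    · simp [evalAt, Fin.sum_univ_two, MvPolynomial.pderiv_X]
      ring

/-- The stream function of a divergence-free polynomial field, a primitive of the closed form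
`B₁ dx₂ - B₂ dx₁`. -/
lemma exists_stream_function (p q : MvPolynomial (Fin 2) ℝ)
    (h : MvPolynomial.pderiv 0 p + MvPolynomial.pderiv 1 q = 0) :
    ∃ ψ : Plane → ℝ, ∀ x, HasFDerivAt ψ
      (evalAt p x • (EuclideanSpace.proj 1 : Plane →L[ℝ] ℝ)
        - evalAt q x • (EuclideanSpace.proj 0 : Plane →L[ℝ] ℝ)) x := by
  have hω : ∀ x : Plane, HasFDerivAt (fun x => evalAt p x • (EuclideanSpace.proj 1 : Plane →L[ℝ] ℝ)
      - evalAt q x • (EuclideanSpace.proj 0 : Plane →L[ℝ] ℝ))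
      ((∑ i, evalAt (MvPolynomial.pderiv i p) x • (EuclideanSpace.proj i : Plane →L[ℝ] ℝ)).smulRight
          (EuclideanSpace.proj 1 : Plane →L[ℝ] ℝ)
        - (∑ i, evalAt (MvPolynomial.pderiv i q) x •
            (EuclideanSpace.proj i : Plane →L[ℝ] ℝ)).smulRight
          (EuclideanSpace.proj 0 : Plane →L[ℝ] ℝ)) x := fun x =>
    ((hasFDerivAt_evalAt p x).smul_const (EuclideanSpace.proj 1 : Plane →L[ℝ] ℝ)).sub
      ((hasFDerivAt_evalAt q x).smul_const (EuclideanSpace.proj 0 : Plane →L[ℝ] ℝ))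
  obtain ⟨ψ, hψ⟩ := (convex_univ (𝕜 := ℝ) (E := Plane)).exists_forall_hasFDerivAt_of_fderiv_symmetric
    isOpen_univ (fun x _ => (hω x).differentiableAt.differentiableWithinAt) (by
      intro a _ x y
      rw [(hω a).fderiv]
      have ha : evalAt (MvPolynomial.pderiv 0 p) a + evalAt (MvPolynomial.pderiv 1 q) a = 0 := by
        have := congrArg (fun r => evalAt r a) h
        simpa [evalAt] using this
      simp [Fin.sum_univ_two]
      linear_combination (x 0 * y 1 - x 1 * y 0) * ha)
  exact ⟨ψ, fun x => hψ x (Set.mem_univ x)⟩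

namespace PolygonalCell

variable (K : PolygonalCell)

lemma edgeLength_pos (j : Fin K.numEdges) : 0 < K.edgeLength j := by
  have h3 := K.three_le
  refine dist_pos.2 fun h => ?_
  have hj : j = finRotate K.numEdges j := K.vertex_injective h
  obtain ⟨n, hn⟩ : ∃ n, K.numEdges = n + 2 := ⟨K.numEdges - 2, by omega⟩
  have hmem : j ∈ (finRotate K.numEdges).support := by
    have : ∀ m, m = n + 2 → (finRotate m).support = Finset.univ := by
      rintro m rfl; exact support_finRotate
    rw [this _ hn]; exact Finset.mem_univ j
  exact Equiv.Perm.mem_support.1 hmem hj.symm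

lemma perimeter_pos : 0 < K.perimeter := by
  have h3 := K.three_le
  have : Nonempty (Fin K.numEdges) := ⟨⟨0, by omega⟩⟩
  exact Finset.sum_pos (fun j _ => K.edgeLength_pos j) Finset.univ_nonempty

lemma edgeLength_smul_normal (j : Fin K.numEdges) : K.edgeLength j • K.normal j
    = !₂[K.nextVertex j 1 - K.vertex j 1, K.vertex j 0 - K.nextVertex j 0] := by
  rw [normal, smul_smul, mul_inv_cancel₀ (K.edgeLength_pos j).ne', one_smul]

lemma norm_normal (j : Fin K.numEdges) : ‖K.normal j‖ = 1 := by
  have h := K.edgeLength_pos j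
  rw [normal, norm_smul, norm_inv, Real.norm_of_nonneg h.le]
  have : ‖(!₂[K.nextVertex j 1 - K.vertex j 1, K.vertex j 0 - K.nextVertex j 0] : Plane)‖
      = K.edgeLength j := by
    rw [edgeLength, EuclideanSpace.norm_eq, EuclideanSpace.dist_eq]
    simp [Fin.sum_univ_two, Real.dist_eq, add_comm]
    rw [sub_sq_comm (K.nextVertex j 1)]
  rw [this, inv_mul_cancel₀ h.ne']

lemma sum_nextVertex {α : Type*} [AddCommMonoid α] (f : Plane → α) :
    ∑ j, f (K.nextVertex j) = ∑ j, f (K.vertex j) :=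
  Equiv.sum_comp (finRotate K.numEdges) (fun j => f (K.vertex j))

lemma sum_edgeLength_smul_normal : ∑ j, K.edgeLength j • K.normal j = 0 := by
  have h : ∀ i, ∑ j, K.nextVertex j i = ∑ j, K.vertex j i := fun i =>
    K.sum_nextVertex fun x => x i
  simp only [edgeLength_smul_normal]
  ext i
  fin_cases i <;> simp [Finset.sum_sub_distrib, h]

lemma area_pos : 0 < K.area := by
  have h1 : 0 < volume K.region :=
    (isOpen_interior.measure_pos volume K.interior_nonempty).trans_le
      (measure_mono interior_subset)
  exact ENNReal.toReal_pos h1.ne' K.isCompact_region.measure_ne_top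

/-- The total flux of a divergence-free polynomial field through a closed polygon vanishes, since
the flux through an edge is the difference of the stream function at its end points. -/
lemma sum_integral_flux_eq_zero (p q : MvPolynomial (Fin 2) ℝ)
    (h : MvPolynomial.pderiv 0 p + MvPolynomial.pderiv 1 q = 0) :
    ∑ j, K.edgeLength j * (K.normal j 0 *
        (∫ t in (0 : ℝ)..1, evalAt p (AffineMap.lineMap (K.vertex j) (K.nextVertex j) t))
      + K.normal j 1 *
        ∫ t in (0 : ℝ)..1, evalAt q (AffineMap.lineMap (K.vertex j) (K.nextVertex j) t)) = 0 := by
  obtain ⟨ψ, hψ⟩ := exists_stream_function p q h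
  have hcont : ∀ (r : MvPolynomial (Fin 2) ℝ) (x y : Plane),
      Continuous fun t : ℝ => evalAt r (AffineMap.lineMap x y t) := fun r x y =>
    (continuous_evalAt r).comp AffineMap.lineMap_continuous
  have hedge : ∀ j, K.edgeLength j * (K.normal j 0 *
        (∫ t in (0 : ℝ)..1, evalAt p (AffineMap.lineMap (K.vertex j) (K.nextVertex j) t))
      + K.normal j 1 *
        ∫ t in (0 : ℝ)..1, evalAt q (AffineMap.lineMap (K.vertex j) (K.nextVertex j) t))
      = ψ (K.nextVertex j) - ψ (K.vertex j) := by
    intro j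
    have h0 : K.edgeLength j * K.normal j 0 = K.nextVertex j 1 - K.vertex j 1 := by
      simpa using congrArg (fun v : Plane => v 0) (K.edgeLength_smul_normal j)
    have h1 : K.edgeLength j * K.normal j 1 = K.vertex j 0 - K.nextVertex j 0 := by
      simpa using congrArg (fun v : Plane => v 1) (K.edgeLength_smul_normal j)
    rw [mul_add, ← mul_assoc, ← mul_assoc, h0, h1, ← intervalIntegral.integral_const_mul,
      ← intervalIntegral.integral_const_mul, ← intervalIntegral.integral_add
        (((hcont p _ _).const_mul _).intervalIntegrable _ _)
        (((hcont q _ _).const_mul _).intervalIntegrable _ _)]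
    rw [intervalIntegral.integral_eq_sub_of_hasDerivAt
      (f := fun t => ψ (AffineMap.lineMap (K.vertex j) (K.nextVertex j) t))]
    · simp
    · intro t _
      refine ((hψ _).comp_hasDerivAt t AffineMap.hasDerivAt_lineMap).congr_deriv ?_
      simp
      ring
    · exact (((hcont p _ _).const_mul _).add ((hcont q _ _).const_mul _)).intervalIntegrable _ _
  simp only [hedge, Finset.sum_sub_distrib, K.sum_nextVertex, sub_self]

end PolygonalCell

/-! ### The update of the cell averages -/

section Update

variable {ι : Type*} {M : PolygonalMesh ι} {k Q : ℕ} {G : EdgeQuadrature M k Q}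

lemma stateAt_mag (P : Fin 8 → MvPolynomial (Fin 2) ℝ) (x : Plane) (ξ : Plane) :
    pair ξ (mag (stateAt P x)) = ξ 0 * evalAt (P 4) x + ξ 1 * evalAt (P 5) x := by
  simp [pair_apply, mag, stateAt]

lemma EdgeQuadrature.sum_weight (K : ι) : ∑ q, G.weight q = 1 := by
  have h3 := (M.cell K).three_le
  have := G.exact_of_degree_le K ⟨0, by omega⟩ 1 (by simp)
  simpa [evalAt] using this.symm

lemma CellQuadrature.sum_weight (C : CellQuadrature G) (K : ι) :
    ∑ j, ∑ q, C.edgeWeight K j q + ∑ q, C.innerWeight K q = 1 := by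
  have := C.exact_of_degree_le K 1 (by simp)
  have harea := (M.cell K).area_pos.ne'
  simp only [evalAt, map_one, mul_one, setIntegral_const, smul_eq_mul] at this
  rw [← this]
  exact (inv_mul_cancel₀ harea)

lemma CellQuadrature.cellAverage_eq (C : CellQuadrature G) (K : ι)
    {P : Fin 8 → MvPolynomial (Fin 2) ℝ} (hP : ∀ l, (P l).totalDegree ≤ k) :
    cellAverage (M.cell K) P = ∑ j, ∑ q, C.edgeWeight K j q • stateAt P (G.node K j q)
      + ∑ q, C.innerWeight K q • stateAt P (C.innerNode K q) := by
  ext l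
  simp only [cellAverage, C.exact_of_degree_le K (P l) (hP l), Pi.add_apply, Finset.sum_apply,
    Pi.smul_apply, smul_eq_mul, stateAt]

lemma CellQuadrature.node_mem_points (C : CellQuadrature G) (K : ι)
    (j : Fin (M.cell K).numEdges) (q : Fin Q) : G.node K j q ∈ C.points K :=
  Or.inr (Set.mem_iUnion.2 ⟨j, q, rfl⟩)

lemma CellQuadrature.innerNode_mem_points (C : CellQuadrature G) (K : ι)
    (q : Fin (C.numInner K)) : C.innerNode K q ∈ C.points K :=
  Or.inl ⟨q, rfl⟩

lemma CellQuadrature.node_mem_points_of_neighbor (C : CellQuadrature G) {K L : ι}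
    {j : Fin (M.cell K).numEdges} (h : M.neighbor K j = some L) (q : Fin Q) :
    G.node K j q ∈ C.points L := by
  obtain ⟨-, i, hi⟩ := M.neighbor_some K j L h
  have hq : G.node K j q ∈ Set.range (G.node L i) := by
    rw [G.shared K j L i h hi]
    exact ⟨q, rfl⟩
  exact Or.inr (Set.mem_iUnion.2 ⟨i, hq⟩)

lemma intState_mem {C : CellQuadrature G} {P : ι → Fin 8 → MvPolynomial (Fin 2) ℝ}
    (hadm : ∀ K, ∀ x ∈ C.points K, stateAt (P K) x ∈ admissible) (K : ι)
    (j : Fin (M.cell K).numEdges) (q : Fin Q) : intState G P K j q ∈ admissible :=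
  hadm K _ (C.node_mem_points K j q)

lemma extState_mem {C : CellQuadrature G} {P : ι → Fin 8 → MvPolynomial (Fin 2) ℝ}
    {bd : BoundaryData M Q} (hbd : ∀ K j, M.neighbor K j = none → ∀ q, bd K j q ∈ admissible)
    (hadm : ∀ K, ∀ x ∈ C.points K, stateAt (P K) x ∈ admissible) (K : ι)
    (j : Fin (M.cell K).numEdges) (q : Fin Q) : extState G bd P K j q ∈ admissible := by
  unfold extState
  split
  · next L h => exact hadm L _ (C.node_mem_points_of_neighbor h q)
  · next h => exact hbd K j h q

/-- The quadrature is exact for the magnetic field, so the discrete flux of the divergence-free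
field through the boundary of a cell is the exact one, namely zero. -/
lemma sum_pair_normal_mag_eq_zero {P : ι → Fin 8 → MvPolynomial (Fin 2) ℝ}
    (hdiv : P ∈ locallyDivFree ι k) (K : ι) :
    ∑ j, ∑ q, (M.cell K).edgeLength j * G.weight q
      * pair ((M.cell K).normal j) (mag (intState G P K j q)) = 0 := by
  obtain ⟨hdeg, hd⟩ := hdiv K
  rw [← (M.cell K).sum_integral_flux_eq_zero _ _ hd]
  refine Finset.sum_congr rfl fun j _ => ?_
  rw [G.exact_of_degree_le K j _ (hdeg 4), G.exact_of_degree_le K j _ (hdeg 5), Finset.mul_sum,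
    Finset.mul_sum, ← Finset.sum_add_distrib, Finset.mul_sum]
  refine Finset.sum_congr rfl fun q _ => ?_
  rw [intState, stateAt_mag]
  ring

/-- The energy flux through the boundary of a cell. The terms which are linear in the magnetic
field vanish by the divergence-free condition, those independent of the state because the polygon
is closed. -/
lemma sum_dualForm_normalFlux_le (eos : EOS) {P : ι → Fin 8 → MvPolynomial (Fin 2) ℝ}
    (hdiv : P ∈ locallyDivFree ι k) (K : ι)
    (hint : ∀ j q, intState G P K j q ∈ admissible) (u b : Vec3) :
    ∑ j, ∑ q, (M.cell K).edgeLength j * G.weight q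
        * dualForm u b (normalFlux eos ((M.cell K).normal j) (intState G P K j q))
      ≤ ∑ j, ∑ q, (M.cell K).edgeLength j * G.weight q
        * (alphaHat eos G P K j q * relEnergy u b (intState G P K j q)) := by
  have hclosed : ∑ j, (M.cell K).edgeLength j * pair ((M.cell K).normal j) u = 0 :=
    sum_mul_pair_eq_zero (M.cell K).sum_edgeLength_smul_normal u
  have hconst : ∑ j, ∑ q, (M.cell K).edgeLength j * G.weight q
      * (pair ((M.cell K).normal j) u * (‖b‖ ^ 2 / 2)) = 0 := by
    have : ∀ j, ∑ q, (M.cell K).edgeLength j * G.weight q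
        * (pair ((M.cell K).normal j) u * (‖b‖ ^ 2 / 2))
        = (M.cell K).edgeLength j * pair ((M.cell K).normal j) u
          * ((∑ q, G.weight q) * (‖b‖ ^ 2 / 2)) := by
      intro j
      rw [Finset.sum_mul, Finset.mul_sum]
      exact Finset.sum_congr rfl fun q _ => by ring
    simp only [this, ← Finset.sum_mul, hclosed, zero_mul]
  have hB : ∑ j, ∑ q, (M.cell K).edgeLength j * G.weight q
      * (pair ((M.cell K).normal j) (mag (intState G P K j q)) * inner ℝ u b) = 0 := by
    simp only [← mul_assoc, ← Finset.sum_mul, sum_pair_normal_mag_eq_zero hdiv K, zero_mul]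
  have hsplit : ∑ j, ∑ q, (M.cell K).edgeLength j * G.weight q
      * dualForm u b (normalFlux eos ((M.cell K).normal j) (intState G P K j q))
      = ∑ j, ∑ q, (M.cell K).edgeLength j * G.weight q
        * relFlux eos u b ((M.cell K).normal j) (intState G P K j q) := by
    simp only [dualForm_normalFlux_eq eos (hint _ _).1, mul_add, mul_sub, Finset.sum_add_distrib,
      Finset.sum_sub_distrib, hconst, hB]
    ring
  rw [hsplit, Finset.sum_comm]
  conv_rhs => rw [Finset.sum_comm]
  refine Finset.sum_le_sum fun q _ => ?_
  have := sum_relFlux_le eos (fun j => (M.cell K).edgeLength j)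
    (fun j => ((M.cell K).edgeLength_pos j).le) (M.cell K).perimeter_pos (M.cell K).normal
    (M.cell K).norm_normal (M.cell K).sum_edgeLength_smul_normal
    (fun j => intState G P K j q) (fun j => hint j q) u b
  have := mul_le_mul_of_nonneg_left this (G.weight_pos q).le
  rw [Finset.mul_sum, Finset.mul_sum] at this
  refine le_of_eq_of_le ?_ (this.trans_eq ?_)
  · exact Finset.sum_congr rfl fun j _ => by ring
  · refine Finset.sum_congr rfl fun j _ => ?_
    simp only [alphaHat, PolygonalCell.perimeter]
    ring

/-- An affine functional which is positive at the nodes, and whose flux through the boundary is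
controlled by the speeds of the CFL condition, stays positive in the update. -/
lemma affine_update_pos (eos : EOS) (σ : HLLSpeeds) (C : CellQuadrature G)
    (bd : BoundaryData M Q) {P : ι → Fin 8 → MvPolynomial (Fin 2) ℝ} (K : ι)
    (hdeg : ∀ l, (P K l).totalDegree ≤ k) {Δt : ℝ} (hΔt : 0 < Δt)
    (hCFL : ∀ j q, Δt * ((M.cell K).edgeLength j / (M.cell K).area) * alphaCFL eos σ G bd P K j q
      < C.edgeWeight K j q / G.weight q)
    (φ : State →ₗ[ℝ] ℝ) (c : ℝ)
    (hφ : ∀ x ∈ C.points K, 0 < φ (stateAt (P K) x) + c)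
    (hflux : ∑ j, ∑ q, (M.cell K).edgeLength j * G.weight q *
        φ (hllFlux eos σ (intState G P K j q) (extState G bd P K j q) ((M.cell K).normal j)
          - (eta σ G bd P K j q * pair ((M.cell K).normal j)
              (mag (extState G bd P K j q) - mag (intState G P K j q)))
            • source (intState G P K j q))
      ≤ ∑ j, ∑ q, (M.cell K).edgeLength j * G.weight q *
        (alphaCFL eos σ G bd P K j q * (φ (intState G P K j q) + c))) :
    0 < φ (cellAverage (M.cell K) (P K) + Δt • spatialOperator eos σ G bd P K) + c := by
  have harea := (M.cell K).area_pos
  -- The weights sum to one, so the constant can be distributed over the nodes.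
  have hc : c = ∑ j, ∑ q, C.edgeWeight K j q * c + ∑ q, C.innerWeight K q * c := by
    simp only [← Finset.sum_mul]
    rw [← add_mul, C.sum_weight K, one_mul]
  have hpos : 0 < ∑ j, ∑ q, (C.edgeWeight K j q
      - Δt * (M.cell K).area⁻¹ * ((M.cell K).edgeLength j * G.weight q
        * alphaCFL eos σ G bd P K j q)) * (φ (intState G P K j q) + c) := by
    have h3 := (M.cell K).three_le
    have : Nonempty (Fin (M.cell K).numEdges) := ⟨⟨0, by omega⟩⟩
    have : Nonempty (Fin Q) := by
      by_contra hQ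
      rw [not_nonempty_iff] at hQ
      simpa using G.sum_weight K
    refine Finset.sum_pos (fun j _ => Finset.sum_pos (fun q _ => ?_) Finset.univ_nonempty)
      Finset.univ_nonempty
    refine mul_pos ?_ (hφ _ (C.node_mem_points K j q))
    have := hCFL j q
    rw [lt_div_iff₀ (G.weight_pos q)] at this
    rw [sub_pos]
    refine lt_of_eq_of_lt ?_ this
    rw [div_eq_mul_inv]
    ring
  have hinner : 0 ≤ ∑ q, C.innerWeight K q * (φ (stateAt (P K) (C.innerNode K q)) + c) :=
    Finset.sum_nonneg fun q _ => mul_nonneg (C.innerWeight_pos K q).le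
      (hφ _ (C.innerNode_mem_points K q)).le
  have hscaled := mul_le_mul_of_nonneg_left hflux
    (by positivity : 0 ≤ Δt * (M.cell K).area⁻¹)
  have hexpand : ∑ j, ∑ q, (C.edgeWeight K j q
      - Δt * (M.cell K).area⁻¹ * ((M.cell K).edgeLength j * G.weight q
        * alphaCFL eos σ G bd P K j q)) * (φ (intState G P K j q) + c)
      = ∑ j, ∑ q, C.edgeWeight K j q * φ (intState G P K j q)
        + ∑ j, ∑ q, C.edgeWeight K j q * c
        - Δt * (M.cell K).area⁻¹ * ∑ j, ∑ q, (M.cell K).edgeLength j * G.weight q *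
        (alphaCFL eos σ G bd P K j q * (φ (intState G P K j q) + c)) := by
    simp only [Finset.mul_sum, ← Finset.sum_add_distrib, ← Finset.sum_sub_distrib]
    exact Finset.sum_congr rfl fun j _ => Finset.sum_congr rfl fun q _ => by ring
  rw [C.cellAverage_eq K hdeg, spatialOperator]
  simp only [map_add, map_smul, map_neg, map_sum, smul_eq_mul]
  rw [hexpand] at hpos
  simp only [mul_add, Finset.sum_add_distrib] at hinner
  simp only [intState] at *
  linarith

lemma alphaCFL_ge (eos : EOS) {σ : HLLSpeeds} {bd : BoundaryData M Q}
    {P : ι → Fin 8 → MvPolynomial (Fin 2) ℝ} {K : ι} {j : Fin (M.cell K).numEdges} {q : Fin Q}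
    (hint : intState G P K j q ∈ admissible) (hext : extState G bd P K j q ∈ admissible) :
    pair ((M.cell K).normal j) (vel (intState G P K j q)) - sigmaMinus σ G bd P K j q
      ≤ alphaCFL eos σ G bd P K j q := by
  have h1 := speedC_nonneg eos (intState G P K j q) ((M.cell K).normal j)
  have h2 : 0 ≤ 2 / (M.cell K).perimeter
      * ∑ i, (M.cell K).edgeLength i * magJump (intState G P K j q) (intState G P K i q) :=
    mul_nonneg (div_nonneg two_pos.le (M.cell K).perimeter_pos.le)
      (Finset.sum_nonneg fun i _ => mul_nonneg ((M.cell K).edgeLength_pos i).le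
        (magJump_nonneg _ _))
  have h3 : eta σ G bd P K j q * (√(rho (intState G P K j q)))⁻¹
      * |pair ((M.cell K).normal j)
          (mag (intState G P K j q) - mag (extState G bd P K j q))| ≤ 0 :=
    mul_nonpos_of_nonpos_of_nonneg (mul_nonpos_of_nonpos_of_nonneg
      (upwindFactor_nonpos hint hext ((M.cell K).norm_normal j)) (by positivity)) (abs_nonneg _)
  have h4 := le_max_left (pair ((M.cell K).normal j) (vel (intState G P K j q)))
    (1 / (M.cell K).perimeter
        * ∑ i, (M.cell K).edgeLength i
            * pair ((M.cell K).normal j - (M.cell K).normal i)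
                (roeVel (intState G P K j q) (intState G P K i q)))
  rw [alphaCFL, alphaHat]
  linarith

end Update

end MHD

theorem theorem4p2 {ι : Type*} (eos : EOS) (M : PolygonalMesh ι) (k Q : ℕ)
    (G : EdgeQuadrature M k Q) (C : CellQuadrature G) (σ : HLLSpeeds)
    (bd : BoundaryData M Q)
    (hbd : ∀ K j, M.neighbor K j = none → ∀ q, bd K j q ∈ admissible)
    (P : ι → Fin 8 → MvPolynomial (Fin 2) ℝ)
    (hdiv : P ∈ locallyDivFree ι k)
    (hadm : ∀ K, ∀ x ∈ C.points K, stateAt (P K) x ∈ admissible)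
    (hσ : ∀ K j q, WaveSpeedCondition eos σ (intState G P K j q) (extState G bd P K j q)
      ((M.cell K).normal j))
    (Ubar : ι → State) (hUbar : ∀ K, Ubar K = cellAverage (M.cell K) (P K))
    (Δt : ℝ) (hΔt : 0 < Δt)
    (hCFL : ∀ K j q,
      Δt * ((M.cell K).edgeLength j / (M.cell K).area) * alphaCFL eos σ G bd P K j q
        < C.edgeWeight K j q / G.weight q) :
    ∀ K, Ubar K + Δt • spatialOperator eos σ G bd P K ∈ admissible := by
  intro K
  have hint := intState_mem hadm K
  have hext := extState_mem hbd hadm K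
  have hn := (M.cell K).norm_normal
  have hweight : ∀ j q, 0 ≤ (M.cell K).edgeLength j * G.weight q := fun j q =>
    mul_nonneg ((M.cell K).edgeLength_pos j).le (G.weight_pos q).le
  rw [hUbar K]
  refine mem_admissible_of_relEnergy_pos ?_ fun u b => ?_
  -- The density is the functional `U ↦ U 0`, and the relative energies are the other ones.
  · have := affine_update_pos eos σ C bd K (hdiv K).1 hΔt (hCFL K)
      (LinearMap.proj 0 : State →ₗ[ℝ] ℝ) 0 (fun x hx => ?_) ?_
    · simpa [rho] using this
    · simpa [rho] using (hadm K x hx).1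
    · refine Finset.sum_le_sum fun j _ => Finset.sum_le_sum fun q _ =>
        mul_le_mul_of_nonneg_left ?_ (hweight j q)
      rw [add_zero]
      refine (rho_hllFlux_le (hint j q) (hext j q) (hn j) (hσ K j q) _).trans ?_
      rw [← sub_mul]
      exact mul_le_mul_of_nonneg_right (alphaCFL_ge eos (hint j q) (hext j q)) (hint j q).1.le
  · refine affine_update_pos eos σ C bd K (hdiv K).1 hΔt (hCFL K) (dualForm u b) (‖b‖ ^ 2 / 2)
      (fun x hx => relEnergy_pos (hadm K x hx) u b) ?_
    have h1 : ∀ j q, _ := fun j q => mul_le_mul_of_nonneg_left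
      (dualForm_hllFlux_sub_source_le (hint j q) (hext j q) (hn j) (hσ K j q) u b) (hweight j q)
    have h2 := sum_dualForm_normalFlux_le eos hdiv K hint u b
    refine (Finset.sum_le_sum fun j _ => Finset.sum_le_sum fun q _ => h1 j q).trans ?_
    simp only [mul_add, Finset.sum_add_distrib] at h2 ⊢
    refine (add_le_add_left h2 _).trans_eq ?_
    simp only [← Finset.sum_add_distrib]
    refine Finset.sum_congr rfl fun j _ => Finset.sum_congr rfl fun q _ => ?_
    rw [alphaCFL, relEnergy, sigmaMinus, eta]
    ring
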